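/- For a finite simple graph $G$ and a set $S$ of its vertices let $E_G(S)$ be the number of edges of $G$ with at least one end point in $S$. An instance of Partial Vertex Cover (PVC) on planar graphs is a triple $(G,k,t)$ with $G$ a finite simple planar graph and $k\ge 1$, $t\ge 0$ integers; it is a yes-instance if some vertex set $S$ with $|S|=k$ satisfies $E_G(S)\ge t$. The parameter is $k$. An instance of weighted PVC is a tuple $(H,\rho,k',t')$ with $H$ a finite simple graph, $\rho\colon V(H)\to\mathbb{N}$ and $k',t'\in\mathbb{N}$; it is a yes-instance if some $S'\subseteq V(H)$ with $|S'|=k'$ satisfies $E_H(S')+\sum_{v\in S'}\rho(v)\ge t'$. PVC on planar graphs, parameterized by $k$, admits a polynomial compression into weighted PVC: there is an algorithm that, given any instance $(G,k,t)$ of PVC on planar graphs, runs in time polynomial in the size of the instance plus $k$ and outputs an instance $(H,\rho,k,t')$ of weighted PVC (with the same $k$) such that $(G,k,t)$ is a yes-instance if and only if $(H,\rho,k,t')$ is, and such that the bit length of the encoding of the output is bounded by a polynomial in $k$ alone. Moreover, $H$ has $O(k^3)$ vertices, and each weight $\rho(v)$, $v\in V(H)$, can be encoded using $O(k)$ bits;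 the constants are absolute. -/

import Mathlib

/-! ### Planar graphs -/

/-- The Euclidean plane. -/
abbrev Plane : Type := EuclideanSpace ℝ (Fin 2)

/-- `A` is a simple arc with end points `x` and `y`: the image of an injective continuous
path from `x` to `y`. -/
def IsArc (x y : Plane) (A : Set Plane) : Prop :=
  ∃ γ : Path x y, Function.Injective γ ∧ Set.range γ = A

/-- A drawing of a graph in the plane without crossings: vertices are distinct points, every edge
is a simple arc joining its two end vertices and passing through no other vertex, and two distinct
edges meet only in common end vertices. -/
structure PlaneDrawing {V : Type*} (G : SimpleGraph V) where
  pos : V → Plane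
  arc : Sym2 V → Set Plane
  pos_injective : Function.Injective pos
  isArc : ∀ u v : V, G.Adj u v → IsArc (pos u) (pos v) (arc s(u, v))
  vertex_mem : ∀ e ∈ G.edgeSet, ∀ w : V, pos w ∈ arc e → w ∈ e
  edge_inter : ∀ e ∈ G.edgeSet, ∀ e' ∈ G.edgeSet, e ≠ e' →
    ∀ x ∈ arc e ∩ arc e', ∃ w : V, w ∈ e ∧ w ∈ e' ∧ x = pos w

/-- A graph is planar if it has a drawing in the plane without crossings. -/
def SimpleGraph.IsPlanar {V : Type*} (G : SimpleGraph V) : Prop :=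
  Nonempty (PlaneDrawing G)

/-! ### A random access machine with a step count

Programs work on natural-number registers and on finitely many memories (arrays) with indirect
addressing. The only arithmetic is addition and truncated subtraction, so in `T` steps the bit
length of the numbers grows by `O(T)` at most, and unit cost is polynomially related to the time
of a Turing machine. -/

/-- The contents of the registers and of the memories. -/
structure Store where
  reg : ℕ → ℕ
  mem : ℕ → ℕ → ℕ

/-- `s.setReg r v` writes `v` into register `r`. -/
def Store.setReg (s : Store) (r v : ℕ) : Store :=
  { s with reg := Function.update s.reg r v }

/-- `s.setMem a i v` writes `v` into cell `i` of memory `a`. -/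
def Store.setMem (s : Store) (a i v : ℕ) : Store :=
  { s with mem := Function.update s.mem a (Function.update (s.mem a) i v) }

/-- Expressions: constants, registers, the cell of memory `a` with a computed address, sums and
truncated differences. -/
inductive Expr where
  | const (c : ℕ) : Expr
  | reg (r : ℕ) : Expr
  | load (a : ℕ) (i : Expr) : Expr
  | add (e₁ e₂ : Expr) : Expr
  | sub (e₁ e₂ : Expr) : Expr

/-- The value of an expression. -/
def Expr.eval (s : Store) : Expr → ℕ
  | .const c => c
  | .reg r => s.reg r
  | .load a i => s.mem a (i.eval s)
  | .add e₁ e₂ => e₁.eval s + e₂.eval s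
  | .sub e₁ e₂ => e₁.eval s - e₂.eval s

/-- Programs. A test succeeds if its expression is nonzero. -/
inductive Prog where
  | skip : Prog
  | assign (r : ℕ) (e : Expr) : Prog
  | store (a : ℕ) (i e : Expr) : Prog
  | seq (P Q : Prog) : Prog
  | cond (e : Expr) (P Q : Prog) : Prog
  | loop (e : Expr) (P : Prog) : Prog

/-- `Prog.Runs P s T s'`: started in `s`, the program `P` halts in `s'` after exactly `T` steps.
Every assignment, memory write and test is one step. -/
inductive Prog.Runs : Prog → Store → ℕ → Store → Prop where
  | skip (s : Store) : Prog.Runs .skip s 1 s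
  | assign (s : Store) (r : ℕ) (e : Expr) :
      Prog.Runs (.assign r e) s 1 (s.setReg r (e.eval s))
  | store (s : Store) (a : ℕ) (i e : Expr) :
      Prog.Runs (.store a i e) s 1 (s.setMem a (i.eval s) (e.eval s))
  | seq {P Q : Prog} {s s' s'' : Store} {T T' : ℕ} :
      Prog.Runs P s T s' → Prog.Runs Q s' T' s'' → Prog.Runs (.seq P Q) s (T + T') s''
  | cond_true {e : Expr} {P Q : Prog} {s s' : Store} {T : ℕ} :
      e.eval s ≠ 0 → Prog.Runs P s T s' → Prog.Runs (.cond e P Q) s (1 + T) s'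
  | cond_false {e : Expr} {P Q : Prog} {s s' : Store} {T : ℕ} :
      e.eval s = 0 → Prog.Runs Q s T s' → Prog.Runs (.cond e P Q) s (1 + T) s'
  | loop_true {e : Expr} {P : Prog} {s s' s'' : Store} {T T' : ℕ} :
      e.eval s ≠ 0 → Prog.Runs P s T s' → Prog.Runs (.loop e P) s' T' s'' →
        Prog.Runs (.loop e P) s (1 + T + T') s''
  | loop_false {e : Expr} {P : Prog} {s : Store} :
      e.eval s = 0 → Prog.Runs (.loop e P) s 1 s

/-- The initial store: the input is in memory `0`, everything else is zero. -/
def Store.init (x : List ℕ) : Store where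
  reg := fun _ => 0
  mem := fun a i => if a = 0 then x.getD i 0 else 0

/-- The program `P` on input `x` halts within `T` steps with the output `y` in the first cells of
memory `1`. -/
def Prog.Outputs (P : Prog) (x : List ℕ) (T : ℕ) (y : List ℕ) : Prop :=
  ∃ T' ≤ T, ∃ s : Store, P.Runs (Store.init x) T' s ∧
    ∀ i (h : i < y.length), s.mem 1 i = y[i]

/-- The size of a list of numbers: the total length of the binary representations, plus one for
each entry. -/
def bitSize (x : List ℕ) : ℕ := (x.map fun a => Nat.size a + 1).sum

/-! ### Polynomial compression -/

/-- A decision problem: its instances, their encodings, and the yes-instances. -/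
structure DecisionProblem where
  Inst : Type
  encode : Inst → List ℕ
  IsYes : Inst → Prop

/-- A parameterized decision problem. -/
structure ParamProblem extends DecisionProblem where
  param : Inst → ℕ

/-- The program `P` is a polynomial compression of the parameterized problem `Q` into the problem
`R`, and `f` is the function on instances that it computes: the running time is polynomial in the
size of the instance plus the parameter, the size of the output is polynomial in the parameter
alone, and the output is an equivalent instance of `R`. -/
def IsPolynomialCompression (Q : ParamProblem) (R : DecisionProblem) (P : Prog)
    (f : Q.Inst → R.Inst) : Prop :=
  ∃ p q : Polynomial ℕ, ∀ x : Q.Inst,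
    P.Outputs (Q.encode x) (p.eval (bitSize (Q.encode x) + Q.param x)) (R.encode (f x)) ∧
    bitSize (R.encode (f x)) ≤ q.eval (Q.param x) ∧
    (Q.IsYes x ↔ R.IsYes (f x))

/-! ### Partial vertex cover -/

/-- The number of edges of `G` with at least one end point in `S`. -/
noncomputable def coveredEdges {V : Type*} (G : SimpleGraph V) (S : Finset V) : ℕ :=
  {e ∈ G.edgeSet | ∃ v ∈ S, v ∈ e}.ncard

open Classical in
/-- The adjacency matrix of a graph on `Fin n`, row by row, as a list of `n * n` bits. -/
noncomputable def adjacencyBits {n : ℕ} (G : SimpleGraph (Fin n)) : List ℕ :=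
  List.ofFn fun i : Fin (n * n) => if G.Adj i.divNat i.modNat then 1 else 0

/-- An instance of partial vertex cover: a graph, a solution size `k` and a threshold `t`. -/
structure PVCInstance where
  n : ℕ
  graph : SimpleGraph (Fin n)
  k : ℕ
  t : ℕ

/-- Some `k` vertices cover at least `t` edges. -/
def PVCInstance.IsYes (I : PVCInstance) : Prop :=
  ∃ S : Finset (Fin I.n), S.card = I.k ∧ I.t ≤ coveredEdges I.graph S

/-- The encoding of an instance as a list of numbers. -/
noncomputable def PVCInstance.encode (I : PVCInstance) : List ℕ :=
  I.n :: I.k :: I.t :: adjacencyBits I.graph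

/-- An instance of partial vertex cover with vertex weights. -/
structure WeightedPVCInstance where
  n : ℕ
  graph : SimpleGraph (Fin n)
  weight : Fin n → ℕ
  k : ℕ
  t : ℕ

/-- For some `k` vertices, the number of covered edges plus the weights of the vertices is at
least `t`. -/
def WeightedPVCInstance.IsYes (I : WeightedPVCInstance) : Prop :=
  ∃ S : Finset (Fin I.n), S.card = I.k ∧ I.t ≤ coveredEdges I.graph S + ∑ v ∈ S, I.weight v

/-- The encoding of a weighted instance as a list of numbers. -/
noncomputable def WeightedPVCInstance.encode (I : WeightedPVCInstance) : List ℕ :=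
  I.n :: I.k :: I.t :: (adjacencyBits I.graph ++ List.ofFn I.weight)

/-- Partial vertex cover on planar graphs, parameterized by the (positive) solution size `k`. -/
noncomputable def planarPVC : ParamProblem where
  Inst := {I : PVCInstance // I.graph.IsPlanar ∧ 0 < I.k}
  encode := fun I => I.1.encode
  IsYes := fun I => I.1.IsYes
  param := fun I => I.1.k

/-- Partial vertex cover with vertex weights. -/
noncomputable def weightedPVC : DecisionProblem where
  Inst := WeightedPVCInstance
  encode := WeightedPVCInstance.encode
  IsYes := WeightedPVCInstance.IsYes

/-! Twice the number of edges covered by `S` is `coverValue`: twice the degree sum minus twice the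
number of edges inside `S`. Let `δ` be the `k`-th largest degree. Exchanging a vertex for one whose
degree is larger by at least `k` always gains (`coverValue_lt_swap`), so an optimal set has no
vertex of degree below `δ - k` and contains every vertex of degree above `δ + k`. The candidates are
therefore the vertices of degree at least `δ - k`. Degrees above `δ + k` can be clamped, because
every optimal set loses the same amount, and all degrees can then be shifted down.

It remains to find `O(k³)` candidates `W` that contain an optimal set. The only consequence of
planarity needed is the absence of `K₃,₃`. Choose candidates greedily by decreasing degree, but let
no vertex get more than `τ` chosen neighbours. If the choice `L₀` reaches `(τ + 1) * k` vertices, a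
rejected vertex of a solution can be replaced by some `w` in `L₀` without neighbours in the rest of
the solution (`GreedySet.exists_swap`). Otherwise the rejected vertex has a saturated neighbour `b`.
Since three vertices have at most two common neighbours, double counting shows that fewer than `4 *
k` vertices are saturated (`GreedySet.card_hubs_lt`). For each such `b` repeat the choice among the
neighbours of `b`, and for each vertex `c` saturated there, among the common neighbours of `b` and
`c`. Adjacency of `w` to `b` or `c` does no harm, as the rejected vertex is adjacent to them as
well. On the third level a vertex saturated with three chosen neighbours would complete a `K₃,₃`
with `b` and `c`, so the recursion stops (`Representative.exists_swap`).

The output is the induced graph on `W`, where a vertex weighs its clamped and shifted degree minus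
its degree inside `W`; `Representative.exists_iff` proves the equivalence.

That a planar graph has no `K₃,₃` follows from a parity count of winding numbers: for two disjoint
arcs `γ` and `η`, the function `γ s - η t` has a logarithm on the whole parameter square.

The algorithm is written with loops that run up to the number of vertices, so that termination and a
polynomial time bound can be read off from the syntax (`Cmd.exists_runs`); what it computes is shown
by loop invariants. -/

/-! ### Planar graphs contain no `K₃,₃` -/

/-- A continuous function without zeros on the line or the plane has a continuous logarithm with
any prescribed compatible value at one point, and only one. -/
theorem existsUnique_continuous_log {A : Type*} [TopologicalSpace A] [SimplyConnectedSpace A]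
    [LocallyPathConnectedSpace A] {g : A → ℂ} (hg : Continuous g) (h0 : ∀ a, g a ≠ 0) (a₀ : A)
    {e₀ : ℂ} (he : Complex.exp e₀ = g a₀) :
    ∃! F : C(A, ℂ), F a₀ = e₀ ∧ Complex.exp ∘ F = g :=
  Complex.isCoveringMapOn_exp.existsUnique_continuousMap_lifts ⟨g, hg⟩ he (fun a => h0 a)

theorem exists_continuous_log {A : Type*} [TopologicalSpace A] [SimplyConnectedSpace A]
    [LocallyPathConnectedSpace A] {g : A → ℂ} (hg : Continuous g) (h0 : ∀ a, g a ≠ 0) (a₀ : A) :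
    ∃ F : A → ℂ, Continuous F ∧ ∀ a, Complex.exp (F a) = g a := by
  obtain ⟨F, ⟨-, hF⟩, -⟩ := existsUnique_continuous_log hg h0 a₀ (Complex.exp_log (h0 a₀))
  exact ⟨F, F.continuous, fun a => congrFun hF a⟩

/-- `z` is the change of a continuous logarithm of `g` from `0` to `1`. -/
def IsLogChange (g : ℝ → ℂ) (z : ℂ) : Prop :=
  ∃ F : ℝ → ℂ, Continuous F ∧ (∀ t, Complex.exp (F t) = g t) ∧ z = F 1 - F 0

/-- Two continuous logarithms, shifted by a constant to agree at `0`, are lifts of the same function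
with the same base point. -/
theorem IsLogChange.unique {g : ℝ → ℂ} {z w : ℂ} (hz : IsLogChange g z) (hw : IsLogChange g w) :
    z = w := by
  obtain ⟨F, hF, hFg, rfl⟩ := hz
  obtain ⟨F', hF', hFg', rfl⟩ := hw
  have hg : Continuous g := by
    have : g = fun t => Complex.exp (F t) := funext fun t => (hFg t).symm
    rw [this]; fun_prop
  have h0 : ∀ t, g t ≠ 0 := fun t => hFg t ▸ Complex.exp_ne_zero _
  obtain ⟨E, -, hE⟩ := existsUnique_continuous_log hg h0 0 (hFg 0)
  have h1 := hE ⟨F, hF⟩ ⟨rfl, funext hFg⟩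
  have h2 := hE ⟨fun t => F' t + (F 0 - F' 0), by fun_prop⟩ ⟨by simp, by
    funext t
    simp only [Function.comp_apply, ContinuousMap.coe_mk]
    rw [Complex.exp_add, Complex.exp_sub, hFg', hFg', hFg, div_self (h0 0), mul_one]⟩
  have h3 := DFunLike.congr_fun (h1.trans h2.symm) 1
  simp only [ContinuousMap.coe_mk] at h3
  rw [h3]; ring

theorem exists_isLogChange {g : ℝ → ℂ} (hg : Continuous g) (h0 : ∀ t, g t ≠ 0) :
    ∃ z, IsLogChange g z := by
  obtain ⟨F, hF, h⟩ := exists_continuous_log hg h0 0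
  exact ⟨_, F, hF, h, rfl⟩

theorem IsLogChange.neg {g : ℝ → ℂ} {z : ℂ} (h : IsLogChange g z) :
    IsLogChange (fun t => - g t) z := by
  obtain ⟨F, hF, hFg, rfl⟩ := h
  exact ⟨fun t => F t + Real.pi * Complex.I, by fun_prop, fun t => by
    rw [Complex.exp_add, hFg, Complex.exp_pi_mul_I, mul_neg_one], by ring⟩

/-- Two logarithms of one number differ by a multiple of `2πi`, so fixing logarithms of the end
values leaves a single integer as the unknown. -/
theorem IsLogChange.eq_add {g : ℝ → ℂ} {z u v : ℂ} (h : IsLogChange g z)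
    (hu : Complex.exp u = g 0) (hv : Complex.exp v = g 1) :
    ∃ n : ℤ, z = v - u + n * (2 * Real.pi * Complex.I) := by
  obtain ⟨F, hF, hFg, rfl⟩ := h
  obtain ⟨n, hn⟩ := Complex.exp_eq_exp_iff_exists_int.1 ((hFg 1).trans hv.symm)
  obtain ⟨m, hm⟩ := Complex.exp_eq_exp_iff_exists_int.1 ((hFg 0).trans hu.symm)
  exact ⟨n - m, by rw [hn, hm]; push_cast; ring⟩

/-- The logarithm of the difference of two disjoint curves does not change along the boundary of
the square of parameters. -/
theorem logChange_square {γ η : ℝ → ℂ} (hγ : Continuous γ) (hη : Continuous η)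
    (h : ∀ s t, γ s ≠ η t) {z₁ z₂ z₃ z₄ : ℂ}
    (h₁ : IsLogChange (fun s => γ s - η 0) z₁) (h₂ : IsLogChange (fun t => η t - γ 1) z₂)
    (h₃ : IsLogChange (fun t => η t - γ 0) z₃) (h₄ : IsLogChange (fun s => γ s - η 1) z₄) :
    z₁ + z₂ = z₃ + z₄ := by
  obtain ⟨F, hF, hFg⟩ := exists_continuous_log (A := ℝ × ℝ) (g := fun x => γ x.1 - η x.2)
    (by fun_prop) (fun x => sub_ne_zero.2 (h _ _)) (0, 0)
  have e₁ := h₁.unique ⟨fun s => F (s, 0), by fun_prop, fun s => hFg _, rfl⟩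
  have e₄ := h₄.unique ⟨fun s => F (s, 1), by fun_prop, fun s => hFg _, rfl⟩
  have e₂ := h₂.neg.unique ⟨fun t => F (1, t), by fun_prop, fun t => by rw [hFg]; simp, rfl⟩
  have e₃ := h₃.neg.unique ⟨fun t => F (0, t), by fun_prop, fun t => by rw [hFg]; simp, rfl⟩
  rw [e₁, e₂, e₃, e₄]; ring

/-- A logarithm of `p b - p a`, chosen so that the logarithms of opposite differences differ by
`π * I`. -/
noncomputable def orderedLog (p : Fin 3 → ℂ) (a b : Fin 3) : ℂ :=
  if a < b then Complex.log (p b - p a) else Complex.log (p a - p b) + Real.pi * Complex.I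

theorem exp_orderedLog {p : Fin 3 → ℂ} {a b : Fin 3} (h : p a ≠ p b) :
    Complex.exp (orderedLog p a b) = p b - p a := by
  unfold orderedLog
  split_ifs
  · exact Complex.exp_log (sub_ne_zero.2 h.symm)
  · rw [Complex.exp_add, Complex.exp_log (sub_ne_zero.2 h), Complex.exp_pi_mul_I]; ring

theorem orderedLog_swap {p : Fin 3 → ℂ} {a b : Fin 3} (h : a < b) :
    orderedLog p b a = orderedLog p a b + Real.pi * Complex.I := by
  simp [orderedLog, h, h.not_gt]

/-- `K₃,₃` cannot be drawn with curves such that disjoint edges do not meet. -/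
theorem not_exists_curves_K33 (p q : Fin 3 → ℂ) (γ : Fin 3 → Fin 3 → ℝ → ℂ)
    (hc : ∀ i j, Continuous (γ i j)) (h0 : ∀ i j, γ i j 0 = p i) (h1 : ∀ i j, γ i j 1 = q j)
    (hd : ∀ i i' j j', i ≠ i' → j ≠ j' → ∀ s t, γ i j s ≠ γ i' j' t) : False := by
  have other : ∀ i : Fin 3, ∃ j, i ≠ j := by decide
  have hpp : ∀ a b, a ≠ b → p a ≠ p b := fun a b hab => by
    have := hd a b 0 1 hab (by decide) 0 0
    rwa [h0, h0] at this
  have hqq : ∀ a b, a ≠ b → q a ≠ q b := fun a b hab => by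
    have := hd 0 1 a b (by decide) hab 1 1
    rwa [h1, h1] at this
  have hpq : ∀ a x, q x ≠ p a := fun a x => by
    obtain ⟨b, hb⟩ := other a
    obtain ⟨y, hy⟩ := other x
    have := hd a b y x hb hy.symm 0 1
    rw [h0, h1] at this
    exact this.symm
  -- The integer records how often the edge from `p a` to `q x` winds around `p b`, relative to
  -- fixed logarithms of its end directions.
  have n1 : ∀ b a x, b ≠ a → ∃ n : ℤ, IsLogChange (fun t => γ a x t - p b)
      (Complex.log (q x - p b) - orderedLog p b a + n * (2 * Real.pi * Complex.I)) := by
    intro b a x hab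
    obtain ⟨y, hy⟩ := other x
    obtain ⟨z, hz⟩ := exists_isLogChange (g := fun t => γ a x t - p b)
      (by have := hc a x; fun_prop) (fun t => by
        have := hd a b x y hab.symm hy t 0
        rw [h0] at this
        exact sub_ne_zero.2 this)
    obtain ⟨n, hn⟩ := hz.eq_add (u := orderedLog p b a) (v := Complex.log (q x - p b))
      (by rw [exp_orderedLog (hpp _ _ hab), h0])
      (by rw [Complex.exp_log (sub_ne_zero.2 (hpq _ _)), h1])
    exact ⟨n, hn ▸ hz⟩
  -- The same around `q y`. The logarithm at the start is that of the opposite difference plus `πi`,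
  -- so that it cancels against an end value in `n1`.
  have n2 : ∀ y a x, y ≠ x → ∃ n : ℤ, IsLogChange (fun t => γ a x t - q y)
      (orderedLog q y x - (Complex.log (q y - p a) + Real.pi * Complex.I)
        + n * (2 * Real.pi * Complex.I)) := by
    intro y a x hyx
    obtain ⟨b, hb⟩ := other a
    obtain ⟨z, hz⟩ := exists_isLogChange (g := fun t => γ a x t - q y)
      (by have := hc a x; fun_prop) (fun t => by
        have := hd a b x y hb hyx.symm t 1
        rw [h1] at this
        exact sub_ne_zero.2 this)
    obtain ⟨n, hn⟩ := hz.eq_add (u := Complex.log (q y - p a) + Real.pi * Complex.I)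
      (v := orderedLog q y x)
      (by rw [Complex.exp_add, Complex.exp_log (sub_ne_zero.2 (hpq _ _)), h0,
            Complex.exp_pi_mul_I]; ring)
      (by rw [exp_orderedLog (hqq _ _ hyx), h1])
    exact ⟨n, hn ▸ hz⟩
  choose! N1 hN1 using n1
  choose! N2 hN2 using n2
  -- Around the parameter square of two disjoint edges the logarithms of the differences `q - p`
  -- cancel. What remains are the half turns from `orderedLog_swap`, which add up to one full turn
  -- or none.
  have key : ∀ a b x y, a < b → x ≠ y →
      N1 b a x + N2 x b y - N1 a b y - N2 y a x = if x < y then 1 else 0 := by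
    intro a b x y hab hxy
    have hsq := logChange_square (hc a x) (hc b y) (hd a b x y hab.ne hxy)
      (by rw [h0]; exact hN1 b a x hab.ne') (by rw [h1]; exact hN2 x b y hxy)
      (by rw [h0]; exact hN1 a b y hab.ne) (by rw [h1]; exact hN2 y a x hxy.symm)
    rw [orderedLog_swap hab] at hsq
    have hpi : (2 * Real.pi * Complex.I : ℂ) ≠ 0 := Complex.two_pi_I_ne_zero
    have : ((N1 b a x + N2 x b y - N1 a b y - N2 y a x : ℤ) : ℂ)
        = ((if x < y then 1 else 0 : ℤ) : ℂ) := by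
      apply mul_right_cancel₀ hpi
      split_ifs with h
      · rw [orderedLog_swap h] at hsq
        push_cast
        linear_combination hsq
      · rw [orderedLog_swap (lt_of_le_of_ne (not_lt.1 h) hxy.symm)] at hsq
        push_cast
        linear_combination hsq
    exact_mod_cast this
  have k1 := fun x y h => key 0 1 x y (by decide) h
  have k2 := fun x y h => key 0 2 x y (by decide) h
  have k3 := fun x y h => key 1 2 x y (by decide) h
  have row : ∀ f : Fin 3 → Fin 3 → ℤ, (∀ x y, x ≠ y → f x y = if x < y then 1 else 0) →
      f 0 1 + f 0 2 + f 1 0 + f 1 2 + f 2 0 + f 2 1 = 3 := fun f hf => by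
    rw [hf 0 1 (by decide), hf 0 2 (by decide), hf 1 0 (by decide), hf 1 2 (by decide),
      hf 2 0 (by decide), hf 2 1 (by decide)]
    decide
  have r1 := row _ k1
  have r2 := row _ k2
  have r3 := row _ k3
  -- Parity: summed over all `x ≠ y`, every `N1` term occurs twice. With `M a` the sum of `N2 y a x`
  -- over `x ≠ y`, all three differences `M 1 - M 0`, `M 2 - M 0`, `M 2 - M 1` are odd, which is
  -- impossible.
  omega

/-- The graph has no three vertices with three common neighbours. -/
def SimpleGraph.K33Free {V : Type*} (G : SimpleGraph V) : Prop :=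
  ∀ p q : Fin 3 → V, Function.Injective p → Function.Injective q → ¬ ∀ i j, G.Adj (p i) (q j)

/-- Two edges of a `K₃,₃` without a common end vertex are drawn as disjoint arcs; reading the plane
as `ℂ` gives the curves excluded by `not_exists_curves_K33`. -/
theorem SimpleGraph.IsPlanar.k33Free {V : Type*} {G : SimpleGraph V} (hG : G.IsPlanar) :
    G.K33Free := by
  obtain ⟨D⟩ := hG
  intro p q hp hq hadj
  choose γ hγ hr using fun i j => D.isArc _ _ (hadj i j)
  let c : Plane → ℂ := fun x => ⟨x 0, x 1⟩
  have hc : Continuous c := by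
    have : c = fun x => ((x 0 : ℝ) : ℂ) + ((x 1 : ℝ) : ℂ) * Complex.I := by
      funext x; apply Complex.ext <;> simp [c]
    rw [this]; fun_prop
  have hci : Function.Injective c := fun x y h => by
    have h0 := congrArg Complex.re h
    have h1 := congrArg Complex.im h
    ext i
    fin_cases i
    · exact h0
    · exact h1
  have hpq : ∀ i j, p i ≠ q j := fun i j => (hadj i j).ne
  refine not_exists_curves_K33 (fun i => c (D.pos (p i))) (fun j => c (D.pos (q j)))
    (fun i j t => c ((γ i j).extend t))
    (fun i j => hc.comp (γ i j).continuous_extend) (by simp) (by simp) ?_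
  intro i i' j j' hi hj s t hst
  have h := hci hst
  have m1 : (γ i j).extend s ∈ D.arc s(p i, q j) := by
    rw [← hr, ← _root_.Path.extend_range]; exact ⟨s, rfl⟩
  have m2 : (γ i j).extend s ∈ D.arc s(p i', q j') := by
    rw [h, ← hr, ← _root_.Path.extend_range]; exact ⟨t, rfl⟩
  obtain ⟨w, h1, h2, -⟩ := D.edge_inter _ (hadj i j) _ (hadj i' j') (by
    simp only [ne_eq, Sym2.eq_iff, not_or, not_and]
    exact ⟨fun h => absurd (hp h) hi, fun h => absurd h (hpq _ _)⟩) _ ⟨m1, m2⟩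
  rw [Sym2.mem_iff] at h1 h2
  rcases h1 with rfl | rfl <;> rcases h2 with h2 | h2
  · exact hi (hp h2)
  · exact hpq _ _ h2
  · exact hpq _ _ h2.symm
  · exact hj (hq h2)

/-! ### The number of covered edges in terms of degrees -/

namespace SimpleGraph

set_option linter.unusedSectionVars false

variable {V : Type*} [DecidableEq V] (G : SimpleGraph V) [DecidableRel G.Adj]

/-- The number of neighbours of `v` in `S`. -/
def nbCount (v : V) (S : Finset V) : ℕ := (S.filter (G.Adj v)).card

/-- Twice the number of edges inside `S`. -/
def innerDeg (S : Finset V) : ℕ := ∑ v ∈ S, G.nbCount v S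

/-- Twice the number of edges covered by `S`, if `d` gives the degrees. -/
def coverValue (d : V → ℕ) (S : Finset V) : ℤ := 2 * (∑ v ∈ S, d v : ℕ) - G.innerDeg S

variable {G}

theorem nbCount_mono {v : V} {S T : Finset V} (h : S ⊆ T) : G.nbCount v S ≤ G.nbCount v T :=
  Finset.card_le_card (Finset.filter_subset_filter _ h)

theorem nbCount_le (v : V) (S : Finset V) : G.nbCount v S ≤ S.card := Finset.card_filter_le _ _

theorem nbCount_insert {v u : V} {S : Finset V} (hu : u ∉ S) :
    G.nbCount v (insert u S) = G.nbCount v S + if G.Adj v u then 1 else 0 := by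
  unfold nbCount
  rw [Finset.filter_insert]
  split_ifs
  · rw [Finset.card_insert_of_notMem (by simp [hu])]
  · rfl

theorem innerDeg_insert {v : V} {S : Finset V} (hv : v ∉ S) :
    G.innerDeg (insert v S) = G.innerDeg S + 2 * G.nbCount v S := by
  unfold innerDeg
  rw [Finset.sum_insert hv, nbCount_insert hv, if_neg (G.loopless.irrefl v), add_zero,
    Finset.sum_congr rfl fun u _ => nbCount_insert (v := u) hv, Finset.sum_add_distrib,
    ← Finset.card_filter]
  have : (S.filter fun u => G.Adj u v).card = G.nbCount v S := by
    simp only [nbCount, G.adj_comm]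
  rw [this]; ring

theorem coverValue_insert {d : V → ℕ} {v : V} {S : Finset V} (hv : v ∉ S) :
    G.coverValue d (insert v S) = G.coverValue d S + 2 * d v - 2 * G.nbCount v S := by
  unfold coverValue
  rw [innerDeg_insert hv, Finset.sum_insert hv]; push_cast; ring

theorem coverValue_erase {d : V → ℕ} {v : V} {S : Finset V} (hv : v ∈ S) :
    G.coverValue d S =
      G.coverValue d (S.erase v) + 2 * d v - 2 * G.nbCount v (S.erase v) := by
  conv_lhs => rw [← Finset.insert_erase hv]
  exact coverValue_insert (Finset.notMem_erase v S)

/-- Induction on `S`: a new vertex `v` newly covers exactly its edges to vertices outside `S`, of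
which there are its degree minus `nbCount v S`. -/
theorem two_mul_coveredEdges [Fintype V] (S : Finset V) :
    (2 * coveredEdges G S : ℤ) = G.coverValue (fun v => G.nbCount v Finset.univ) S := by
  induction S using Finset.induction_on with
  | empty => simp [coveredEdges, coverValue, innerDeg]
  | insert v S hv ih =>
    rw [coverValue_insert hv, ← ih]
    have hset : {e ∈ G.edgeSet | ∃ w ∈ insert v S, w ∈ e} =
        {e ∈ G.edgeSet | ∃ w ∈ S, w ∈ e} ∪
          (fun u => s(v, u)) '' ((Finset.univ \ S).filter (G.Adj v) : Finset V) := by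
      ext e
      induction e using Sym2.ind with
      | _ a b =>
      simp only [Finset.mem_insert, Sym2.mem_iff, Set.mem_ofPred_eq, SimpleGraph.mem_edgeSet,
        Finset.coe_filter, Finset.mem_sdiff, Finset.mem_univ, true_and, Set.mem_union,
        Set.mem_image]
      constructor
      · rintro ⟨hab, w, rfl | hw, hw'⟩
        · rcases hw' with rfl | rfl
          · by_cases hb : b ∈ S
            · exact Or.inl ⟨hab, b, hb, Or.inr rfl⟩
            · exact Or.inr ⟨b, ⟨hb, hab⟩, rfl⟩
          · by_cases ha : a ∈ S
            · exact Or.inl ⟨hab, a, ha, Or.inl rfl⟩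
            · exact Or.inr ⟨a, ⟨ha, hab.symm⟩, Sym2.eq_swap⟩
        · exact Or.inl ⟨hab, w, hw, hw'⟩
      · rintro (⟨hab, w, hw, hw'⟩ | ⟨u, ⟨hu, hvu⟩, h⟩)
        · exact ⟨hab, w, Or.inr hw, hw'⟩
        · rw [← mem_edgeSet, ← h]
          refine ⟨hvu, v, Or.inl rfl, ?_⟩
          rw [← Sym2.mem_iff, ← h]; simp
    have hdisj : Disjoint {e ∈ G.edgeSet | ∃ w ∈ S, w ∈ e}
        ((fun u => s(v, u)) '' ((Finset.univ \ S).filter (G.Adj v) : Finset V)) := by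
      rw [Set.disjoint_left]
      rintro e ⟨-, w, hw, hwe⟩ ⟨u, hu, rfl⟩
      simp only [Finset.coe_filter, Finset.mem_sdiff, Finset.mem_univ, true_and,
        Set.mem_ofPred_eq] at hu
      rcases Sym2.mem_iff.1 hwe with rfl | rfl
      · exact hv hw
      · exact hu.1 hw
    have hcard : coveredEdges G (insert v S) =
        coveredEdges G S + ((Finset.univ \ S).filter (G.Adj v)).card := by
      unfold coveredEdges
      rw [hset, Set.ncard_union_eq hdisj (Set.toFinite _) (Set.toFinite _),
        Set.ncard_image_of_injective, Set.ncard_coe_finset]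
      exact fun a b h => Sym2.congr_right.1 h
    have hsplit : G.nbCount v Finset.univ =
        ((Finset.univ \ S).filter (G.Adj v)).card + G.nbCount v S := by
      unfold nbCount
      rw [← Finset.card_union_of_disjoint, ← Finset.filter_union,
        Finset.sdiff_union_of_subset (Finset.subset_univ _)]
      exact Finset.disjoint_filter_filter Finset.sdiff_disjoint
    rw [hcard, hsplit]; push_cast; ring

theorem innerDeg_le_sum {d : V → ℕ} {S : Finset V} (h : ∀ v ∈ S, S.card ≤ d v) :
    G.innerDeg S ≤ ∑ v ∈ S, d v :=
  Finset.sum_le_sum fun v hv => (nbCount_le v S).trans (h v hv)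

/-- Replacing a vertex of `S` by one whose degree exceeds it by `S.card` covers more edges. -/
theorem coverValue_lt_swap {d : V → ℕ} {S : Finset V} {u x : V} (hu : u ∈ S) (hx : x ∉ S)
    (h : d u + S.card ≤ d x) :
    G.coverValue d S < G.coverValue d (insert x (S.erase u)) := by
  rw [coverValue_erase hu, coverValue_insert (fun hh => hx (Finset.mem_of_mem_erase hh))]
  have h1 : G.nbCount x (S.erase u) ≤ (S.erase u).card := nbCount_le _ _
  have h2 := Finset.card_erase_add_one hu
  omega

/-! ### Greedy sets of candidates -/

variable (G)

/-- `L` is the result of a greedy choice of at most `m` vertices of `E` in the order of decreasing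
degree, such that every vertex `x` of `U` has at most `cap x` neighbours in `L`. -/
structure GreedySet (U E : Finset V) (d cap : V → ℕ) (m : ℕ) (L : Finset V) : Prop where
  subset : L ⊆ E
  card_le : L.card ≤ m
  nbCount_le : ∀ x ∈ U, G.nbCount x L ≤ cap x
  maximal : ∀ v ∈ E, v ∉ L → (L.card = m ∧ ∀ w ∈ L, d v ≤ d w) ∨
    ∃ x ∈ U, G.Adj v x ∧ G.nbCount x L = cap x

/-- The bound `τ` for the vertices outside `Y`, and no effective bound for those in `Y`. -/
def capOutside (Y : Finset V) (τ m : ℕ) (x : V) : ℕ := if x ∈ Y then m + 1 else τ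

/-- `W` contains greedy sets for all relevant sets of at most two common neighbours. -/
def Representative (U E : Finset V) (d : V → ℕ) (k : ℕ) (W : Finset V) : Prop :=
  ∃ L₀ ⊆ W, G.GreedySet U E d (capOutside ∅ (66 * (k * k)) ((66 * (k * k) + 1) * k))
      ((66 * (k * k) + 1) * k) L₀ ∧
    ∀ b ∈ U, G.nbCount b L₀ = capOutside ∅ (66 * (k * k)) ((66 * (k * k) + 1) * k) b →
    ∃ L₁ ⊆ W, G.GreedySet U (E.filter (G.Adj b)) d
        (capOutside {b} (12 * k) ((12 * k + 1) * k)) ((12 * k + 1) * k) L₁ ∧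
      ∀ c ∈ U, G.nbCount c L₁ = capOutside {b} (12 * k) ((12 * k + 1) * k) c →
      ∃ L₂ ⊆ W, G.GreedySet U ((E.filter (G.Adj b)).filter (G.Adj c)) d
        (capOutside {b, c} 3 (4 * k)) (4 * k) L₂

variable {G}

/-- The capacity `m + 1` given to the vertices of `Y` exceeds `L.card`, so they are never saturated.
-/
theorem GreedySet.card_filter_capOutside {U E : Finset V} {d : V → ℕ} {Y : Finset V} {τ m : ℕ}
    {L : Finset V} (h : G.GreedySet U E d (capOutside Y τ m) m L) {x : V}
    (hx : G.nbCount x L = capOutside Y τ m x) : x ∉ Y ∧ G.nbCount x L = τ := by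
  unfold capOutside at hx
  split_ifs at hx with hY
  · have := SimpleGraph.nbCount_le (G := G) x L
    have := h.card_le
    omega
  · exact ⟨hY, hx⟩

/-- A vertex of `S` that is adjacent to all of `Y` can be replaced by some vertex of a full greedy
set for `Y`. -/
theorem GreedySet.exists_swap {U E : Finset V} {d : V → ℕ} {Y : Finset V} {τ m : ℕ}
    {L : Finset V} (h : G.GreedySet U E d (capOutside Y τ m) m L) {S : Finset V} (hS : S ⊆ U)
    {v : V} (hv : v ∈ S) (hY : ∀ y ∈ Y, G.Adj v y) (hL : L.card = m) (hd : ∀ w ∈ L, d v ≤ d w)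
    (hm : (τ + 1) * S.card ≤ m) :
    ∃ w ∈ L, w ∉ S.erase v ∧
      G.coverValue d S ≤ G.coverValue d (insert w (S.erase v)) := by
  set S' := S.erase v with hS'
  -- `B` is what the replacement must avoid: the rest of the solution and the chosen neighbours of
  -- its members outside `Y`. Its size is at most `(S.card - 1) * (τ + 1)`, less than `m`.
  set B := S' ∪ (S' \ Y).biUnion fun x => L.filter (G.Adj x) with hB
  have hcard : S'.card + 1 = S.card := Finset.card_erase_add_one hv
  have h1 : ((S' \ Y).biUnion fun x => L.filter (G.Adj x)).card ≤ S'.card * τ := by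
    refine (Finset.card_biUnion_le_card_mul _ _ τ fun x hx => ?_).trans
      (Nat.mul_le_mul_right _ (Finset.card_le_card Finset.sdiff_subset))
    rw [Finset.mem_sdiff] at hx
    have := h.nbCount_le x (hS (Finset.mem_of_mem_erase hx.1))
    rwa [capOutside, if_neg hx.2] at this
  have h2 : B.card < L.card := by
    refine (Finset.card_union_le _ _).trans_lt ?_
    rw [hL]
    nlinarith
  obtain ⟨w, hwL, hwB⟩ := Finset.exists_mem_notMem_of_card_lt_card h2
  simp only [hB, Finset.mem_union, Finset.mem_biUnion, Finset.mem_filter, not_or, not_exists,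
    not_and, Finset.mem_sdiff] at hwB
  refine ⟨w, hwL, hwB.1, ?_⟩
  rw [coverValue_erase hv, coverValue_insert hwB.1]
  -- All neighbours of `w` in `S'` lie in `Y`, hence are neighbours of `v`. So `w` loses no more to
  -- inner edges than `v`, and its degree is at least as large.
  have h3 : G.nbCount w S' ≤ G.nbCount v S' := by
    refine Finset.card_le_card fun x hx => ?_
    rw [Finset.mem_filter] at hx ⊢
    refine ⟨hx.1, hY x ?_⟩
    by_contra hxY
    exact hwB.2 x ⟨hx.1, hxY⟩ hwL hx.2.symm
  have := hd w hwL
  rw [← hS']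
  omega

/-- Three common neighbours would form a `K₃,₃` with the three vertices of `T`. -/
theorem K33Free.card_common_le (hG : G.K33Free) {T : Finset V} (hT : T.card = 3) (L : Finset V) :
    (L.filter fun p => ∀ x ∈ T, G.Adj x p).card ≤ 2 := by
  by_contra hlt
  obtain ⟨Q, hQ, hQ3⟩ := Finset.exists_subset_card_eq (Nat.succ_le_of_lt (not_le.1 hlt))
  let e := (Finset.equivFinOfCardEq hT).symm
  let f := (Finset.equivFinOfCardEq hQ3).symm
  exact hG (fun i => e i) (fun i => f i) (Subtype.val_injective.comp e.injective)
    (Subtype.val_injective.comp f.injective)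
    fun i j => (Finset.mem_filter.1 (hQ (f j).2)).2 _ (e i).2

/-- Once `d ≥ q`, increasing `d` by one increases the binomial coefficient by `d.choose q ≥ 1`. -/
theorem le_add_choose (q d : ℕ) : d ≤ q + d.choose (q + 1) := by
  induction d with
  | zero => simp
  | succ d ih =>
    rw [Nat.choose_succ_succ']
    rcases le_or_gt q d with h | h
    · have := Nat.choose_pos h
      omega
    · omega

/-- If any `q + 1` vertices of `R` have at most two common neighbours in `L`, then there are few
edges between `R` and `L`. -/
theorem sum_nbCount_le {R L : Finset V} {q : ℕ}
    (h : ∀ T ⊆ R, T.card = q + 1 → (L.filter fun p => ∀ x ∈ T, G.Adj x p).card ≤ 2) :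
    ∑ x ∈ R, G.nbCount x L ≤ q * L.card + 2 * R.card ^ (q + 1) := by
  calc ∑ x ∈ R, G.nbCount x L
      -- Count from the side of `L`: a vertex with `d` neighbours in `R` contributes at most `q`
      -- plus the number of `(q + 1)`-subsets of these neighbours, and each subset is counted for at
      -- most two vertices of `L`.
      = ∑ p ∈ L, (R.filter fun x => G.Adj x p).card := by
        simp only [nbCount]
        exact Finset.sum_card_bipartiteAbove_eq_sum_card_bipartiteBelow G.Adj
    _ ≤ ∑ p ∈ L, (q + (R.powersetCard (q + 1) |>.filter fun T => ∀ x ∈ T, G.Adj x p).card) := by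
        refine Finset.sum_le_sum fun p _ => (le_add_choose q _).trans ?_
        rw [← Finset.card_powersetCard]
        refine Nat.add_le_add_left (Finset.card_le_card fun T hT => ?_) _
        rw [Finset.mem_powersetCard] at hT
        rw [Finset.mem_filter, Finset.mem_powersetCard]
        exact ⟨⟨hT.1.trans (Finset.filter_subset _ _), hT.2⟩,
          fun x hx => (Finset.mem_filter.1 (hT.1 hx)).2⟩
    _ = q * L.card + ∑ p ∈ L,
          (R.powersetCard (q + 1) |>.filter fun T => ∀ x ∈ T, G.Adj x p).card := by
        rw [Finset.sum_add_distrib, Finset.sum_const, smul_eq_mul, mul_comm]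
    _ = q * L.card + ∑ T ∈ R.powersetCard (q + 1),
          (L.filter fun p => ∀ x ∈ T, G.Adj x p).card := by
        congr 1
        exact Finset.sum_card_bipartiteAbove_eq_sum_card_bipartiteBelow
          (fun (p : V) (T : Finset V) => ∀ x ∈ T, G.Adj x p)
    _ ≤ q * L.card + (R.powersetCard (q + 1)).card * 2 := by
        refine Nat.add_le_add_left ?_ _
        rw [← smul_eq_mul]
        exact Finset.sum_le_card_nsmul _ _ _ fun T hT =>
          h T (Finset.mem_powersetCard.1 hT).1 (Finset.mem_powersetCard.1 hT).2
    _ ≤ q * L.card + 2 * R.card ^ (q + 1) := by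
        rw [Finset.card_powersetCard, mul_comm _ 2]
        have := Nat.choose_le_pow R.card (q + 1)
        omega

/-- The number of vertices with many neighbours in a greedy set is bounded. -/
theorem GreedySet.card_hubs_lt (hG : G.K33Free) {U E : Finset V} {d : V → ℕ} {Y : Finset V}
    {τ m q k : ℕ} {L : Finset V} (h : G.GreedySet U E d (capOutside Y τ m) m L)
    (hY : ∀ y ∈ Y, ∀ v ∈ E, G.Adj y v) (hq : Y.card + (q + 1) = 3)
    (hk : q * m + 2 * (4 * k) ^ (q + 1) < 4 * k * τ) :
    (U.filter fun x => G.nbCount x L = capOutside Y τ m x).card < 4 * k := by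
  by_contra hlt
  obtain ⟨R, hR, hRk⟩ := Finset.exists_subset_card_eq (not_lt.1 hlt)
  have hRY : ∀ x ∈ R, x ∉ Y ∧ G.nbCount x L = τ := fun x hx =>
    h.card_filter_capOutside (Finset.mem_filter.1 (hR hx)).2
  -- Since `L` lies in the common neighbourhood of `Y`, any `q + 1` saturated vertices together with
  -- `Y` are three vertices with a common neighbourhood, hence share at most two vertices of `L`.
  have h1 := sum_nbCount_le (G := G) (R := R) (L := L) (q := q) fun T hT hTc => by
    refine le_trans (Finset.card_le_card ?_) (hG.card_common_le (T := Y ∪ T) (by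
      rw [Finset.card_union_of_disjoint, hTc, hq]
      exact Finset.disjoint_right.2 fun x hx => (hRY x (hT hx)).1) L)
    intro p hp
    rw [Finset.mem_filter] at hp ⊢
    refine ⟨hp.1, fun x hx => ?_⟩
    rcases Finset.mem_union.1 hx with hx | hx
    · exact hY x hx p (h.subset hp.1)
    · exact hp.2 x hx
  rw [Finset.sum_congr rfl fun x hx => (hRY x hx).2, Finset.sum_const, smul_eq_mul, hRk] at h1
  have := Nat.mul_le_mul_left q h.card_le
  omega

/-- The constant 66 is chosen for this inequality: `2 * m + 2 * (4 * k) ^ 3` is `260 * k ^ 3 + 2 *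
k`, while `4 * k * τ` is `264 * k ^ 3`. -/
theorem GreedySet.card_hubs_lt_zero (hG : G.K33Free) {U E : Finset V} {d : V → ℕ} {k : ℕ}
    (hk : 0 < k) {L : Finset V}
    (h : G.GreedySet U E d (capOutside ∅ (66 * (k * k)) ((66 * (k * k) + 1) * k))
      ((66 * (k * k) + 1) * k) L) :
    (U.filter fun x => G.nbCount x L =
      capOutside ∅ (66 * (k * k)) ((66 * (k * k) + 1) * k) x).card < 4 * k :=
  h.card_hubs_lt hG (q := 2) (by simp) rfl (by
    ring_nf
    have : k ≤ k ^ 3 := Nat.le_self_pow (by norm_num) k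
    omega)

/-- With one common neighbour fixed, pairs replace triples: `m + 2 * (4 * k) ^ 2` is `44 * k ^ 2 +
k`, while `4 * k * τ` is `48 * k ^ 2`. -/
theorem GreedySet.card_hubs_lt_one (hG : G.K33Free) {U E : Finset V} {d : V → ℕ} {k : ℕ}
    (hk : 0 < k) {L : Finset V} {b : V}
    (h : G.GreedySet U (E.filter (G.Adj b)) d
        (capOutside {b} (12 * k) ((12 * k + 1) * k)) ((12 * k + 1) * k) L) :
    (U.filter fun x => G.nbCount x L =
      capOutside {b} (12 * k) ((12 * k + 1) * k) x).card < 4 * k :=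
  h.card_hubs_lt hG (q := 1) (by simp) rfl (by
    ring_nf
    have : k ≤ k ^ 2 := Nat.le_self_pow (by norm_num) k
    omega)

/-- A vertex of `S` outside of a representative set can be replaced by one inside. -/
theorem Representative.exists_swap (hG : G.K33Free) {U E : Finset V} {d : V → ℕ} {k : ℕ}
    {W : Finset V} (h : G.Representative U E d k W) {S : Finset V} (hS : S ⊆ U)
    (hk : S.card = k) {v : V} (hv : v ∈ S) (hvE : v ∈ E) (hvW : v ∉ W) :
    ∃ w ∈ W, w ∉ S.erase v ∧
      G.coverValue d S ≤ G.coverValue d (insert w (S.erase v)) := by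
  obtain ⟨L₀, hL₀, g₀, h⟩ := h
  rcases g₀.maximal v hvE fun hh => hvW (hL₀ hh) with ⟨hc, hd⟩ | ⟨b, hbU, hvb, hb⟩
  · obtain ⟨w, hw, hw'⟩ := g₀.exists_swap hS hv (by simp) hc hd (by rw [hk])
    exact ⟨w, hL₀ hw, hw'⟩
  obtain ⟨L₁, hL₁, g₁, h⟩ := h b hbU hb
  rcases g₁.maximal v (Finset.mem_filter.2 ⟨hvE, hvb.symm⟩) fun hh => hvW (hL₁ hh) with
    ⟨hc, hd⟩ | ⟨c, hcU, hvc, hc⟩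
  · obtain ⟨w, hw, hw'⟩ := g₁.exists_swap hS hv (by simpa using hvb) hc hd (by rw [hk])
    exact ⟨w, hL₁ hw, hw'⟩
  obtain ⟨L₂, hL₂, g₂⟩ := h c hcU hc
  have hcb := (g₁.card_filter_capOutside hc).1
  rw [Finset.mem_singleton] at hcb
  rcases g₂.maximal v (by simp [hvE, hvb.symm, hvc.symm]) fun hh => hvW (hL₂ hh) with
    ⟨hc, hd⟩ | ⟨x, hxU, hvx, hx⟩
  · obtain ⟨w, hw, hw'⟩ := g₂.exists_swap hS hv (by simpa using ⟨hvb, hvc⟩) hc hd (by rw [hk])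
    exact ⟨w, hL₂ hw, hw'⟩
  obtain ⟨hxY, hx3⟩ := g₂.card_filter_capOutside hx
  -- A saturated `x` on the last level is distinct from `b` and `c` and has three neighbours in
  -- `L₂`, all of them common neighbours of `b` and `c`.
  have h3 := hG.card_common_le (T := {x, b, c})
    (by rw [Finset.card_insert_of_notMem hxY, Finset.card_pair (Ne.symm hcb)]) L₂
  have : G.nbCount x L₂ ≤ (L₂.filter fun p => ∀ y ∈ ({x, b, c} : Finset V), G.Adj y p).card := by
    refine Finset.card_le_card fun p hp => ?_
    rw [Finset.mem_filter] at hp ⊢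
    have := g₂.subset hp.1
    simp only [Finset.mem_filter] at this
    refine ⟨hp.1, fun y hy => ?_⟩
    simp only [Finset.mem_insert, Finset.mem_singleton] at hy
    rcases hy with rfl | rfl | rfl
    · exact hp.2
    · exact this.1.2
    · exact this.2
  omega

/-! ### Correctness of the compression -/

theorem exists_mem_notMem_of_lt_card {S T : Finset V} {u : V} (hu : u ∈ S) (huT : u ∉ T)
    (h : S.card ≤ T.card) : ∃ x ∈ T, x ∉ S := by
  by_contra hcon
  push Not at hcon
  have h1 : T ⊆ S.erase u := fun x hx =>
    Finset.mem_erase.2 ⟨fun hxu => huT (hxu ▸ hx), hcon x hx⟩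
  have h2 := Finset.card_le_card h1
  have h3 := Finset.card_erase_add_one hu
  omega

theorem exists_max_coverValue (d : V → ℕ) {U S : Finset V} (hS : S ⊆ U) :
    ∃ S₀ ⊆ U, S₀.card = S.card ∧ G.coverValue d S ≤ G.coverValue d S₀ ∧
      ∀ T ⊆ U, T.card = S.card → G.coverValue d T ≤ G.coverValue d S₀ := by
  obtain ⟨S₀, h0, hmax⟩ := Finset.exists_max_image (U.powersetCard S.card) (G.coverValue d)
    ⟨S, Finset.mem_powersetCard.2 ⟨hS, rfl⟩⟩
  rw [Finset.mem_powersetCard] at h0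
  exact ⟨S₀, h0.1, h0.2, hmax S (Finset.mem_powersetCard.2 ⟨hS, rfl⟩),
    fun T hT hc => hmax T (Finset.mem_powersetCard.2 ⟨hT, hc⟩)⟩

theorem card_insert_erase {S : Finset V} {v w : V} (hv : v ∈ S) (hw : w ∉ S.erase v) :
    (insert w (S.erase v)).card = S.card := by
  rw [Finset.card_insert_of_notMem hw, Finset.card_erase_add_one hv]

theorem insert_erase_subset {S U : Finset V} {v w : V} (hS : S ⊆ U) (hw : w ∈ U) :
    insert w (S.erase v) ⊆ U :=
  Finset.insert_subset hw ((Finset.erase_subset _ _).trans hS)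

/-- An optimal set can be moved into a representative set. -/
theorem Representative.exists_optimal (hG : G.K33Free) {U : Finset V} {d : V → ℕ} {k δ : ℕ}
    (hδ : k ≤ (U.filter fun v => δ ≤ d v).card) {W : Finset V}
    (h : G.Representative U (U.filter fun v => δ ≤ d v + k) d k W) (hW : W ⊆ U)
    {S : Finset V} (hS : S ⊆ U) (hk : S.card = k)
    (hmax : ∀ T ⊆ U, T.card = k → G.coverValue d T ≤ G.coverValue d S) :
    ∃ S' ⊆ W, S'.card = k ∧ G.coverValue d S ≤ G.coverValue d S' := by
  induction hn : (S \ W).card using Nat.strong_induction_on generalizing S with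
  | _ n ih =>
  rcases (S \ W).eq_empty_or_nonempty with he | ⟨v, hv⟩
  · exact ⟨S, Finset.sdiff_eq_empty_iff_subset.1 he, hk, le_rfl⟩
  rw [Finset.mem_sdiff] at hv
  have hvE : v ∈ U.filter fun v => δ ≤ d v + k := by
    rw [Finset.mem_filter]
    refine ⟨hS hv.1, ?_⟩
    -- A vertex of degree below `δ - k` could be exchanged for a missing one of degree at least `δ`,
    -- with strict gain.
    by_contra hlow
    obtain ⟨x, hx, hxS⟩ := exists_mem_notMem_of_lt_card (T := U.filter fun v => δ ≤ d v) hv.1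
      (by rw [Finset.mem_filter]; omega) (hk ▸ hδ)
    rw [Finset.mem_filter] at hx
    have := coverValue_lt_swap (G := G) (d := d) hv.1 hxS (by omega)
    exact absurd (hmax _ (insert_erase_subset hS hx.1) ((card_insert_erase hv.1
      fun hh => hxS (Finset.mem_of_mem_erase hh)).trans hk)) (not_le.2 this)
  obtain ⟨w, hwW, hw, hle⟩ := h.exists_swap hG hS hk hv.1 hvE hv.2
  -- The exchange removes `v` from `S \ W` and adds only a vertex of `W`, so the induction applies;
  -- the new set is again optimal.
  have hlt : (insert w (S.erase v) \ W).card < n := by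
    rw [← hn]
    refine Finset.card_lt_card ?_
    rw [Finset.ssubset_iff_of_subset]
    · exact ⟨v, Finset.mem_sdiff.2 hv, by
        simp only [Finset.mem_sdiff, Finset.mem_insert, Finset.mem_erase]
        rintro ⟨h | h, -⟩
        · exact hv.2 (h ▸ hwW)
        · exact h.1 rfl⟩
    · intro x hx
      simp only [Finset.mem_sdiff, Finset.mem_insert, Finset.mem_erase] at hx ⊢
      rcases hx with ⟨rfl | h, h'⟩
      · exact absurd hwW h'
      · exact ⟨h.2, h'⟩
  obtain ⟨S', h1, h2, h3⟩ := ih _ hlt (insert_erase_subset hS (hW hwW))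
    ((card_insert_erase hv.1 hw).trans hk) (fun T hT hTk => (hmax T hT hTk).trans hle) rfl
  exact ⟨S', h1, h2, hle.trans h3⟩

/-- The clamped and shifted degrees of the compressed instance. -/
def clampedDeg (d : V → ℕ) (k δ N : ℕ) (v : V) : ℕ := min (d v) (δ + k) + N - (δ - k)

/-- The threshold of the compressed instance; `C` is the total amount lost by clamping. -/
def clampedThreshold (k δ N C t : ℕ) : ℕ :=
  min (t + k * N - (C + k * (δ - k))) (k * (2 * k + N) + 1)

theorem clampedDeg_le (d : V → ℕ) (k δ N : ℕ) (v : V) : clampedDeg d k δ N v ≤ 2 * k + N := by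
  unfold clampedDeg; omega

theorem le_clampedDeg {d : V → ℕ} {k δ : ℕ} (N : ℕ) {v : V} (h : δ ≤ d v + k) :
    N ≤ clampedDeg d k δ N v := by
  unfold clampedDeg; omega

/-- Only members of `S` exceed `δ + k`, so the total loss over `W` is already the loss over `S`, and
the identity holds term by term. In particular the correction does not depend on `S`. -/
theorem sum_clampedDeg {d : V → ℕ} {k δ N : ℕ} {W S : Finset V}
    (hW : ∀ v ∈ W, δ ≤ d v + k) (hS : S ⊆ W) (hk : S.card = k)
    (hgood : ∀ v ∈ W, δ + k < d v → v ∈ S) :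
    ∑ v ∈ S, clampedDeg d k δ N v + (∑ v ∈ W, (d v - (δ + k)) + k * (δ - k)) =
      ∑ v ∈ S, d v + k * N := by
  have h1 : ∑ v ∈ W, (d v - (δ + k)) = ∑ v ∈ S, (d v - (δ + k)) :=
    (Finset.sum_subset hS fun v hv hvS => by
      have := mt (hgood v hv) hvS
      omega).symm
  have h2 : k * (δ - k) = ∑ v ∈ S, (δ - k) := by simp [hk]
  have h3 : k * N = ∑ v ∈ S, N := by simp [hk]
  rw [h1, h2, h3, ← Finset.sum_add_distrib, ← Finset.sum_add_distrib, ← Finset.sum_add_distrib]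
  refine Finset.sum_congr rfl fun v hv => ?_
  have := hW v (hS hv)
  unfold clampedDeg
  omega

theorem coverValue_clampedDeg {d : V → ℕ} {k δ N : ℕ} {W S : Finset V}
    (hW : ∀ v ∈ W, δ ≤ d v + k) (hS : S ⊆ W) (hk : S.card = k)
    (hgood : ∀ v ∈ W, δ + k < d v → v ∈ S) :
    G.coverValue (clampedDeg d k δ N) S +
      2 * ((∑ v ∈ W, (d v - (δ + k)) + k * (δ - k) : ℕ) : ℤ) = G.coverValue d S + 2 * (k * N) := by
  have := sum_clampedDeg (N := N) hW hS hk hgood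
  unfold coverValue
  zify at this ⊢
  linarith

/-- In each direction pass to an optimal set, for the true degrees or for the clamped ones.
Optimality puts all vertices of `W` of degree above `δ + k` into it, as it also has a vertex of
degree at most `δ` that could be exchanged. The two values then differ by a constant. -/
theorem Representative.exists_iff (hG : G.K33Free) {U : Finset V} {d : V → ℕ} {k δ : ℕ}
    (hk : 0 < k) (hδ : k ≤ (U.filter fun v => δ ≤ d v).card)
    (hδ' : (U.filter fun v => δ < d v).card < k) {W : Finset V}
    (h : G.Representative U (U.filter fun v => δ ≤ d v + k) d k W)
    (hW : W ⊆ U.filter fun v => δ ≤ d v + k) (t : ℕ) :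
    (∃ S ⊆ U, S.card = k ∧ (2 * t : ℤ) ≤ G.coverValue d S) ↔
      ∃ S ⊆ W, S.card = k ∧ (2 * (clampedThreshold k δ W.card
        (∑ v ∈ W, (d v - (δ + k))) t : ℕ) : ℤ) ≤
          G.coverValue (clampedDeg d k δ W.card) S := by
  have hWU : W ⊆ U := hW.trans (Finset.filter_subset _ _)
  have hWd : ∀ v ∈ W, δ ≤ d v + k := fun v hv => (Finset.mem_filter.1 (hW hv)).2
  have hlow : ∀ S ⊆ U, S.card = k → ∃ u ∈ S, d u ≤ δ := by
    intro S hS hSk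
    obtain ⟨u, hu, hu'⟩ := Finset.exists_mem_notMem_of_card_lt_card (hSk ▸ hδ')
    rw [Finset.mem_filter] at hu'
    exact ⟨u, hu, not_lt.1 fun hh => hu' ⟨hS hu, hh⟩⟩
  -- This is one purpose of the shift by `W.card`: clamped degrees are at least the number of
  -- neighbours within `W`.
  have hnonneg : ∀ S ⊆ W, (G.innerDeg S) ≤ ∑ v ∈ S, clampedDeg d k δ W.card v := fun S hS =>
    innerDeg_le_sum fun v hv => (Finset.card_le_card hS).trans (le_clampedDeg _ (hWd v (hS hv)))
  constructor
  · rintro ⟨S, hS, hSk, ht⟩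
    obtain ⟨S₀, hS₀, hc₀, hle₀, hmax₀⟩ := exists_max_coverValue (G := G) d hS
    rw [hSk] at hc₀ hmax₀
    obtain ⟨S₁, hS₁, hc₁, hle₁⟩ := h.exists_optimal hG hδ hWU hS₀ hc₀ hmax₀
    refine ⟨S₁, hS₁, hc₁, ?_⟩
    have hval := coverValue_clampedDeg (G := G) (N := W.card) hWd hS₁ hc₁ fun v hv hdv => by
      by_contra hvS
      obtain ⟨u, hu, hud⟩ := hlow S₁ (hS₁.trans hWU) hc₁
      have := coverValue_lt_swap (G := G) (d := d) hu hvS (by omega)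
      exact absurd ((hmax₀ _ (insert_erase_subset (hS₁.trans hWU) (hWU hv))
        ((card_insert_erase hu fun hh => hvS (Finset.mem_of_mem_erase hh)).trans hc₁)).trans hle₁)
        (not_le.2 this)
    -- Needed because the truncated subtraction in the threshold may give `0`.
    have hpos : (0 : ℤ) ≤ G.coverValue (clampedDeg d k δ W.card) S₁ := by
      have := hnonneg S₁ hS₁
      unfold coverValue
      omega
    unfold clampedThreshold
    generalize (∑ v ∈ W, (d v - (δ + k)) + k * (δ - k) : ℕ) = C at *
    have : ((k : ℤ) * (W.card : ℤ)) = ((k * W.card : ℕ) : ℤ) := by push_cast; rfl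
    rw [this] at hval
    omega
  · rintro ⟨S, hS, hSk, ht⟩
    obtain ⟨S₀, hS₀, hc₀, hle₀, hmax₀⟩ :=
      exists_max_coverValue (G := G) (clampedDeg d k δ W.card) hS
    rw [hSk] at hc₀ hmax₀
    refine ⟨S₀, hS₀.trans hWU, hc₀, ?_⟩
    have hval := coverValue_clampedDeg (G := G) (N := W.card) hWd hS₀ hc₀ fun v hv hdv => by
      by_contra hvS
      obtain ⟨u, hu, hud⟩ := hlow S₀ (hS₀.trans hWU) hc₀
      have := coverValue_lt_swap (G := G) (d := clampedDeg d k δ W.card) hu hvS (by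
        unfold clampedDeg; have := hWd u (hS₀ hu); omega)
      exact absurd (hmax₀ _ (insert_erase_subset hS₀ hv)
        ((card_insert_erase hu fun hh => hvS (Finset.mem_of_mem_erase hh)).trans hc₀))
        (not_le.2 this)
    -- The cap in `clampedThreshold` is one more than this bound, so a threshold that is reached is
    -- not the cap.
    have hub : ∑ v ∈ S₀, clampedDeg d k δ W.card v ≤ k * (2 * k + W.card) := by
      rw [← hc₀, ← smul_eq_mul]
      nth_rw 1 [hc₀]
      exact Finset.sum_le_card_nsmul _ _ _ fun v _ => hc₀ ▸ clampedDeg_le d _ δ _ v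
    have hub' : G.coverValue (clampedDeg d k δ W.card) S₀ ≤ 2 * (k * (2 * k + W.card) : ℕ) := by
      unfold coverValue
      omega
    unfold clampedThreshold at ht
    generalize (∑ v ∈ W, (d v - (δ + k)) + k * (δ - k) : ℕ) = C at *
    generalize k * (2 * k + W.card) = B at *
    have : ((k : ℤ) * (W.card : ℤ)) = ((k * W.card : ℕ) : ℤ) := by push_cast; rfl
    rw [this] at hval
    omega

end SimpleGraph

/-! ### Programs with bounded loops -/

/-- Programs all of whose loops count a register from `0` up to the value of register `0`. -/
inductive Cmd where
  | skip : Cmd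
  | assign (r : ℕ) (e : Expr) : Cmd
  | store (a : ℕ) (i e : Expr) : Cmd
  | seq (P Q : Cmd) : Cmd
  | cond (e : Expr) (P Q : Cmd) : Cmd
  | loop (i : ℕ) (P : Cmd) : Cmd

namespace Cmd

/-- The effect of `n` rounds of a loop with body `F` and counter `i`. -/
def rounds (F : Store → Store) (i : ℕ) (s : Store) : ℕ → Store
  | 0 => s.setReg i 0
  | j + 1 => (F (rounds F i s j)).setReg i (j + 1)

/-- The effect of a program on the store. -/
def run : Cmd → Store → Store
  | skip, s => s
  | assign r e, s => s.setReg r (e.eval s)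
  | store a i e, s => s.setMem a (i.eval s) (e.eval s)
  | seq P Q, s => Q.run (P.run s)
  | cond e P Q, s => if e.eval s ≠ 0 then P.run s else Q.run s
  | loop i P, s => rounds P.run i s (s.reg 0)

/-- The translation into the general language. -/
def toProg : Cmd → Prog
  | skip => .skip
  | assign r e => .assign r e
  | store a i e => .store a i e
  | seq P Q => .seq P.toProg Q.toProg
  | cond e P Q => .cond e P.toProg Q.toProg
  | loop i P => .seq (.assign i (.const 0)) (.loop (.sub (.reg 0) (.reg i))
      (.seq P.toProg (.assign i (.add (.reg i) (.const 1)))))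

/-- Whether the program writes register `r`. -/
def writes : Cmd → ℕ → Bool
  | skip, _ => false
  | assign r' _, r => r == r'
  | store _ _ _, _ => false
  | seq P Q, r => P.writes r || Q.writes r
  | cond _ P Q, r => P.writes r || Q.writes r
  | loop i P, r => r == i || P.writes r

/-- Whether the program writes memory `a`. -/
def writesMem : Cmd → ℕ → Bool
  | skip, _ => false
  | assign _ _, _ => false
  | store a' _ _, a => a == a'
  | seq P Q, a => P.writesMem a || Q.writesMem a
  | cond _ P Q, a => P.writesMem a || Q.writesMem a
  | loop _ P, a => P.writesMem a

/-- Register `0` is not written, and the bodies of loops do not write the counter. -/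
def wf : Cmd → Bool
  | skip => true
  | assign r _ => r != 0
  | store _ _ _ => true
  | seq P Q => P.wf && Q.wf
  | cond _ P Q => P.wf && Q.wf
  | loop i P => P.wf && !P.writes i && i != 0

/-- A bound for the running time in terms of the value of register `0`. -/
noncomputable def time : Cmd → Polynomial ℕ
  | skip => 1
  | assign _ _ => 1
  | store _ _ _ => 1
  | seq P Q => P.time + Q.time
  | cond _ P Q => 1 + (P.time + Q.time)
  | loop _ P => 1 + (Polynomial.X * (P.time + 2) + 1)

theorem run_reg {c : Cmd} {r : ℕ} (h : c.writes r = false) (s : Store) :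
    (c.run s).reg r = s.reg r := by
  induction c generalizing s with
  | skip => rfl
  | assign r' e =>
    simp only [writes, beq_eq_false_iff_ne] at h
    simp [run, Store.setReg, h]
  | store => rfl
  | seq P Q hP hQ =>
    simp only [writes, Bool.or_eq_false_iff] at h
    rw [run, hQ h.2, hP h.1]
  | cond e P Q hP hQ =>
    simp only [writes, Bool.or_eq_false_iff] at h
    rw [run]
    split_ifs
    · exact hP h.1 s
    · exact hQ h.2 s
  | loop i P hP =>
    simp only [writes, Bool.or_eq_false_iff, beq_eq_false_iff_ne] at h
    rw [run]
    induction s.reg 0 with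
    | zero => simp [rounds, Store.setReg, h.1]
    | succ j ih =>
      rw [← ih, ← hP h.2 (rounds P.run i s j)]
      simp [rounds, Store.setReg, h.1]

theorem run_mem {c : Cmd} {a : ℕ} (h : c.writesMem a = false) (s : Store) :
    (c.run s).mem a = s.mem a := by
  induction c generalizing s with
  | skip => rfl
  | assign r' e => rfl
  | store a' i e =>
    simp only [writesMem, beq_eq_false_iff_ne] at h
    simp [run, Store.setMem, h]
  | seq P Q hP hQ =>
    simp only [writesMem, Bool.or_eq_false_iff] at h
    rw [run, hQ h.2, hP h.1]
  | cond e P Q hP hQ =>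
    simp only [writesMem, Bool.or_eq_false_iff] at h
    rw [run]
    split_ifs
    · exact hP h.1 s
    · exact hQ h.2 s
  | loop i P hP =>
    simp only [writesMem] at h
    rw [run]
    induction s.reg 0 with
    | zero => rfl
    | succ j ih =>
      rw [← ih, ← hP h (rounds P.run i s j)]
      rfl

theorem writes_zero {c : Cmd} (hc : c.wf = true) : c.writes 0 = false := by
  induction c with
  | skip => rfl
  | assign r e =>
    simp only [wf, bne_iff_ne] at hc
    simp [writes, hc.symm]
  | store => rfl
  | seq P Q hP hQ =>
    simp only [wf, Bool.and_eq_true] at hc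
    simp [writes, hP hc.1, hQ hc.2]
  | cond e P Q hP hQ =>
    simp only [wf, Bool.and_eq_true] at hc
    simp [writes, hP hc.1, hQ hc.2]
  | loop i P hP =>
    simp only [wf, Bool.and_eq_true, bne_iff_ne] at hc
    simp [writes, hP hc.1.1, hc.2.symm]

theorem run_reg_zero {c : Cmd} (hc : c.wf = true) (s : Store) : (c.run s).reg 0 = s.reg 0 :=
  run_reg (writes_zero hc) s

theorem rounds_counter (F : Store → Store) (i : ℕ) (s : Store) (j : ℕ) :
    (rounds F i s j).reg i = j := by
  cases j <;> simp [rounds, Store.setReg]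

theorem rounds_reg_zero {P : Cmd} (hP : P.wf = true) {i : ℕ} (hi : i ≠ 0) (s : Store) (j : ℕ) :
    (rounds P.run i s j).reg 0 = s.reg 0 := by
  induction j with
  | zero => simp [rounds, Store.setReg, hi.symm]
  | succ j ih => rw [← ih, ← run_reg_zero hP (rounds P.run i s j)]; simp [rounds, Store.setReg, hi.symm]

/-- The general language executes a well-formed program within the time bound. -/
theorem exists_runs {c : Cmd} (hc : c.wf = true) (s : Store) :
    ∃ T ≤ c.time.eval (s.reg 0), c.toProg.Runs s T (c.run s) := by
  induction c generalizing s with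
  | skip => exact ⟨1, by simp [time], .skip s⟩
  | assign r e => exact ⟨1, by simp [time], .assign s r e⟩
  | store a i e => exact ⟨1, by simp [time], .store s a i e⟩
  | seq P Q hP hQ =>
    simp only [wf, Bool.and_eq_true] at hc
    obtain ⟨T, hT, hr⟩ := hP hc.1 s
    obtain ⟨T', hT', hr'⟩ := hQ hc.2 (P.run s)
    rw [run_reg_zero hc.1] at hT'
    exact ⟨T + T', by rw [time, Polynomial.eval_add]; omega, hr.seq hr'⟩
  | cond e P Q hP hQ =>
    simp only [wf, Bool.and_eq_true] at hc
    by_cases he : e.eval s = 0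
    · obtain ⟨T, hT, hr⟩ := hQ hc.2 s
      refine ⟨1 + T, by simp only [time, Polynomial.eval_add, Polynomial.eval_one]; omega, ?_⟩
      rw [run, if_neg (not_not.2 he)]
      exact .cond_false he hr
    · obtain ⟨T, hT, hr⟩ := hP hc.1 s
      refine ⟨1 + T, by simp only [time, Polynomial.eval_add, Polynomial.eval_one]; omega, ?_⟩
      rw [run, if_pos he]
      exact .cond_true he hr
  | loop i P hP =>
    simp only [wf, Bool.and_eq_true, Bool.not_eq_true', bne_iff_ne] at hc
    obtain ⟨⟨hPw, hPi⟩, hi⟩ := hc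
    obtain ⟨n, hn⟩ : ∃ n, s.reg 0 = n := ⟨_, rfl⟩
    obtain ⟨B, hB⟩ : ∃ B, P.time.eval n = B := ⟨_, rfl⟩
    -- Here `d` is the number of rounds left. Each costs at most `B` for the body plus one step each
    -- for the test and the increment; the last `1` is the failing test.
    have key : ∀ d j, j + d = n → ∃ T ≤ d * (B + 2) + 1,
        Prog.Runs (.loop (.sub (.reg 0) (.reg i))
          (.seq P.toProg (.assign i (.add (.reg i) (.const 1))))) (rounds P.run i s j) T
          (rounds P.run i s n) := by
      intro d
      induction d with
      | zero =>
        rintro j rfl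
        exact ⟨1, by omega, .loop_false (by
          simp [Expr.eval, rounds_counter, rounds_reg_zero hPw hi, hn])⟩
      | succ d ih =>
        intro j hj
        obtain ⟨T, hT, hr⟩ := hP hPw (rounds P.run i s j)
        rw [rounds_reg_zero hPw hi, hn, hB] at hT
        obtain ⟨T', hT', hr'⟩ := ih (j + 1) (by omega)
        have hstep := hr.seq (.assign _ i (.add (.reg i) (.const 1)))
        have he : (Expr.add (.reg i) (.const 1)).eval (P.run (rounds P.run i s j)) = j + 1 := by
          simp [Expr.eval, run_reg hPi, rounds_counter]
        rw [he] at hstep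
        refine ⟨1 + (T + 1) + T', ?_, .loop_true ?_ hstep hr'⟩
        · rw [Nat.succ_mul]; omega
        · simp only [Expr.eval, rounds_counter, rounds_reg_zero hPw hi, hn]; omega
    obtain ⟨T, hT, hr⟩ := key n 0 (by omega)
    rw [run, hn]
    refine ⟨1 + T, ?_, .seq (.assign s i (.const 0)) hr⟩
    simp only [time, Polynomial.eval_add, Polynomial.eval_one, Polynomial.eval_mul,
      Polynomial.eval_X, Polynomial.eval_ofNat, hB]
    omega

/-- The rule for loops: what the body does not write is unchanged. -/
theorem run_loop {i : ℕ} {P : Cmd} {s : Store} (I : ℕ → Store → Prop)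
    (h0 : I 0 (s.setReg i 0))
    (hstep : ∀ j < s.reg 0, ∀ s', s'.reg i = j →
      (∀ r, r ≠ i → P.writes r = false → s'.reg r = s.reg r) →
      (∀ a, P.writesMem a = false → s'.mem a = s.mem a) → I j s' →
      I (j + 1) ((P.run s').setReg i (j + 1))) :
    I (s.reg 0) ((loop i P).run s) := by
  have key : ∀ j ≤ s.reg 0, I j (rounds P.run i s j) ∧
      (∀ r, r ≠ i → P.writes r = false → (rounds P.run i s j).reg r = s.reg r) ∧
      (∀ a, P.writesMem a = false → (rounds P.run i s j).mem a = s.mem a) := by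
    intro j
    induction j with
    | zero => exact fun _ => ⟨h0, fun r hr _ => by simp [rounds, Store.setReg, hr], fun a _ => rfl⟩
    | succ j ih =>
      intro hj
      obtain ⟨h1, h2, h3⟩ := ih (by omega)
      refine ⟨hstep j (by omega) _ (rounds_counter _ _ _ _) h2 h3 h1, fun r hr hw => ?_,
        fun a ha => ?_⟩
      · rw [← h2 r hr hw, ← run_reg hw (rounds P.run i s j)]
        simp [rounds, Store.setReg, hr]
      · rw [← h3 a ha, ← run_mem ha (rounds P.run i s j)]
        rfl
  exact (key _ le_rfl).1

/-- Add up the values of `e` over all rounds in which `b` is nonzero. -/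
def sumIf (i r : ℕ) (b e : Expr) : Cmd :=
  seq (assign r (.const 0)) (loop i (cond b (assign r (.add (.reg r) e)) skip))

/-- Test and summand need to be known only in stores that differ from `s` in the counter and the
accumulator, so users need no invariant of their own. -/
theorem run_sumIf {i r : ℕ} {b e : Expr} {s : Store} (hr : r ≠ 0) (hri : r ≠ i)
    (p : ℕ → Prop) [DecidablePred p] (f : ℕ → ℕ)
    (h : ∀ j < s.reg 0, ∀ s' : Store, s'.reg i = j →
      (∀ q, q ≠ i → q ≠ r → s'.reg q = s.reg q) → s'.mem = s.mem →
      (b.eval s' ≠ 0 ↔ p j) ∧ (p j → e.eval s' = f j)) :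
    ((sumIf i r b e).run s).reg r = ∑ j ∈ (Finset.range (s.reg 0)).filter p, f j := by
  set s₁ := s.setReg r 0 with hs₁
  have hn : s₁.reg 0 = s.reg 0 := by simp [hs₁, Store.setReg, hr.symm]
  have := run_loop (s := s₁) (i := i) (P := cond b (assign r (.add (.reg r) e)) skip)
    (fun j s' => s'.reg r = ∑ j ∈ (Finset.range j).filter p, f j)
    (by simp [hs₁, Store.setReg, hri]) ?_
  · rw [hn] at this
    exact this
  intro j hj s' hji hreg hmem hI
  obtain ⟨hb, he⟩ := h j (by omega) s' hji (fun q hq hqr => by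
    rw [hreg q hq (by simp [writes, hqr])]; simp [hs₁, Store.setReg, hqr])
    (funext fun a => by rw [hmem a (by simp [writesMem])]; rfl)
  rw [Finset.range_add_one, Finset.filter_insert]
  by_cases hp : p j
  · rw [if_pos hp, Finset.sum_insert (by simp)]
    simp [run, hb, hp, Store.setReg, hri, Expr.eval, hI, he hp, add_comm]
  · rw [if_neg hp]
    simp [run, hb, hp, Store.setReg, hri, hI]

/-- Overwrite the first cells of memory `a` by the values of `e`. -/
def mapMem (i a : ℕ) (e : Expr) : Cmd := loop i (store a (.reg i) e)

/-- In round `j` cell `j` still has its old value, which `e` may read. The greedy procedure lowers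
capacities in place this way. -/
theorem run_mapMem {i a : ℕ} {e : Expr} {s : Store} (f : ℕ → ℕ)
    (h : ∀ j < s.reg 0, ∀ s' : Store, s'.reg i = j →
      (∀ q, q ≠ i → s'.reg q = s.reg q) → (∀ a', a' ≠ a → s'.mem a' = s.mem a') →
      s'.mem a j = s.mem a j → e.eval s' = f j) :
    ∀ x < s.reg 0, ((mapMem i a e).run s).mem a x = f x := by
  have := run_loop (s := s) (i := i) (P := store a (.reg i) e)
    (fun j s' => ∀ x, s'.mem a x = if x < j then f x else s.mem a x)
    (by simp [Store.setReg]) ?_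
  · intro x hx
    rw [mapMem, this, if_pos hx]
  intro j hj s' hji hreg hmem hI x
  have he := h j hj s' hji (fun q hq => hreg q hq rfl)
    (fun a' ha => hmem a' (by simp [writesMem, ha])) (by rw [hI, if_neg (lt_irrefl j)])
  simp only [run, Store.setReg, Store.setMem, Expr.eval, he, hji, Function.update_self]
  by_cases hx : x = j
  · subst hx; simp
  · rw [Function.update_of_ne hx, hI]
    simp only [show x < j + 1 ↔ x < j by omega]

end Cmd

/-! ### Boolean tests and constant multiples from sums and truncated differences -/

namespace Expr

/-- The product with a constant. -/
def smul : ℕ → Expr → Expr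
  | 0, _ => .const 0
  | c + 1, e => .add (smul c e) e

/-- Conjunction of bits. -/
def and (e e' : Expr) : Expr := .sub (.add e e') (.const 1)

/-- Negation of a bit, or the test for zero. -/
def not (e : Expr) : Expr := .sub (.const 1) e

/-- The test `e ≤ e'`. -/
def le (e e' : Expr) : Expr := not (.sub e e')

/-- The test `e = e'`. -/
def eq (e e' : Expr) : Expr := and (le e e') (le e' e)

theorem eval_smul (s : Store) (c : ℕ) (e : Expr) : (smul c e).eval s = c * e.eval s := by
  induction c with
  | zero => simp [smul, eval]
  | succ c ih => rw [smul, eval, ih, Nat.succ_mul]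

theorem eval_not (s : Store) (e : Expr) : (not e).eval s = if e.eval s = 0 then 1 else 0 := by
  simp only [not, eval]; split_ifs <;> omega

theorem eval_le (s : Store) (e e' : Expr) :
    (le e e').eval s = if e.eval s ≤ e'.eval s then 1 else 0 := by
  simp only [le, eval_not, eval, Nat.sub_eq_zero_iff_le]

theorem eval_and {s : Store} {e e' : Expr} {p q : Prop} [Decidable p] [Decidable q]
    (h : e.eval s = if p then 1 else 0) (h' : e'.eval s = if q then 1 else 0) :
    (and e e').eval s = if p ∧ q then 1 else 0 := by
  simp only [and, eval, h, h']
  by_cases hp : p <;> by_cases hq : q <;> simp [hp, hq]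

theorem eval_eq (s : Store) (e e' : Expr) :
    (eq e e').eval s = if e.eval s = e'.eval s then 1 else 0 := by
  rw [eq, eval_and (eval_le s e e') (eval_le s e' e)]
  simp only [le_antisymm_iff]

end Expr

/-! ### The greedy procedure -/

namespace SimpleGraph

variable (G : SimpleGraph ℕ) [DecidableRel G.Adj]

/-- In round `(i, v)`, the vertices of degree at least `n - i` and those of degree `n - i - 1` that
are less than `v` have been processed. -/
def Processed (n : ℕ) (d : ℕ → ℕ) (i v u : ℕ) : Prop := n ≤ d u + i ∨ (d u + i + 1 = n ∧ u < v)

/-- The state of the greedy procedure before round `(i, v)`. -/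
structure GreedyPartial (n : ℕ) (E : Finset ℕ) (d cap : ℕ → ℕ) (m i v : ℕ) (L : Finset ℕ) :
    Prop where
  subset : L ⊆ E
  card_le : L.card ≤ m
  nbCount_le : ∀ x < n, G.nbCount x L ≤ cap x
  processed : ∀ w ∈ L, Processed n d i v w
  maximal : ∀ u ∈ E, Processed n d i v u → u ∉ L → (L.card = m ∧ ∀ w ∈ L, d u ≤ d w) ∨
    ∃ x < n, G.Adj u x ∧ G.nbCount x L = cap x

/-- The condition for choosing `v` in round `(i, v)`. -/
def GreedyChoice (n : ℕ) (E : Finset ℕ) (d cap : ℕ → ℕ) (m i v : ℕ) (L : Finset ℕ) : Prop :=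
  (v ∈ E ∧ d v + i + 1 = n ∧ L.card < m) ∧ ∀ x < n, G.Adj v x → G.nbCount x L < cap x

variable {G} {n : ℕ} {E : Finset ℕ} {d cap : ℕ → ℕ} {m i v : ℕ} {L : Finset ℕ}

theorem GreedyPartial.empty (hd : ∀ u ∈ E, d u < n) : G.GreedyPartial n E d cap m 0 0 ∅ where
  subset := by simp
  card_le := by simp
  nbCount_le := by simp [nbCount]
  processed := by simp
  maximal := by
    rintro u hu (h | h)
    · have := hd u hu; omega
    · omega

/-- At the end of row `i` all vertices of `E` of degree `n - i - 1` have been processed, since they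
are less than `n`. -/
theorem GreedyPartial.next_row (h : G.GreedyPartial n E d cap m i n L) (hE : ∀ u ∈ E, u < n) :
    G.GreedyPartial n E d cap m (i + 1) 0 L where
  subset := h.subset
  card_le := h.card_le
  nbCount_le := h.nbCount_le
  processed w hw := by
    rcases h.processed w hw with h | h
    · exact Or.inl (by omega)
    · exact Or.inl (by omega)
  maximal u hu hp := h.maximal u hu (by
    have := hE u hu
    rcases hp with h | h
    · unfold Processed; omega
    · omega)

/-- Only `v` itself can become newly processed. If there is room, it was refused because of a
saturated neighbour; if `L` is full, its members were processed earlier and have at least the degree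
of `v`. -/
theorem GreedyPartial.not_choose (h : G.GreedyPartial n E d cap m i v L)
    (hc : ¬ G.GreedyChoice n E d cap m i v L) : G.GreedyPartial n E d cap m i (v + 1) L where
  subset := h.subset
  card_le := h.card_le
  nbCount_le := h.nbCount_le
  processed w hw := by
    rcases h.processed w hw with h | h
    · exact Or.inl h
    · exact Or.inr ⟨h.1, by omega⟩
  maximal u hu hp huL := by
    by_cases hp' : Processed n d i v u
    · exact h.maximal u hu hp' huL
    · unfold Processed at hp hp'
      have huv : u = v := by omega
      subst huv
      have hdu : d u + i + 1 = n := by omega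
      by_cases hm : L.card < m
      · right
        by_contra hcon
        push Not at hcon
        exact hc ⟨⟨hu, hdu, hm⟩, fun x hx hux =>
          lt_of_le_of_ne (h.nbCount_le x hx) (hcon x hx hux)⟩
      · refine Or.inl ⟨le_antisymm h.card_le (not_lt.1 hm), fun w hw => ?_⟩
        have := h.processed w hw
        unfold Processed at this
        omega

theorem GreedyPartial.notMem (h : G.GreedyPartial n E d cap m i v L) (hd : d v + i + 1 = n) :
    v ∉ L := fun hv => by
  have := h.processed v hv
  unfold Processed at this
  omega

/-- Earlier refusals stay justified: none was due to a full `L`, as there is still room, and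
saturated vertices stay saturated. -/
theorem GreedyPartial.choose (h : G.GreedyPartial n E d cap m i v L)
    (hc : G.GreedyChoice n E d cap m i v L) :
    G.GreedyPartial n E d cap m i (v + 1) (insert v L) := by
  obtain ⟨⟨hv, hdv, hm⟩, hx⟩ := hc
  have hvL := h.notMem hdv
  have hnb : ∀ x < n, G.nbCount x (insert v L) ≤ cap x := fun x hxn => by
    rw [nbCount_insert hvL]
    split_ifs with hadj
    · exact hx x hxn hadj.symm
    · exact h.nbCount_le x hxn
  refine ⟨Finset.insert_subset hv h.subset, ?_, hnb, fun w hw => ?_, fun u hu hp huL => ?_⟩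
  · rw [Finset.card_insert_of_notMem hvL]; exact hm
  · rcases Finset.mem_insert.1 hw with rfl | hw
    · exact Or.inr ⟨hdv, Nat.lt_succ_self _⟩
    · rcases h.processed w hw with h | h
      · exact Or.inl h
      · exact Or.inr ⟨h.1, by omega⟩
  · rw [Finset.mem_insert, not_or] at huL
    have hp' : Processed n d i v u := by unfold Processed at hp ⊢; omega
    rcases h.maximal u hu hp' huL.2 with h1 | ⟨x, hxn, hux, hxc⟩
    · omega
    · exact Or.inr ⟨x, hxn, hux, le_antisymm (hnb x hxn)
        (hxc ▸ nbCount_mono (Finset.subset_insert v L))⟩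

theorem GreedyPartial.greedySet (h : G.GreedyPartial n E d cap m n v L) :
    G.GreedySet (Finset.range n) E d cap m L where
  subset := h.subset
  card_le := h.card_le
  nbCount_le x hx := h.nbCount_le x (Finset.mem_range.1 hx)
  maximal u hu huL := by
    simpa only [Finset.mem_range] using h.maximal u hu (Or.inl (Nat.le_add_left _ _)) huL

end SimpleGraph

/-- The memory `f` holds the characteristic function of `W` below `n`. -/
def Indicates (n : ℕ) (f : ℕ → ℕ) (W : Finset ℕ) : Prop := ∀ v < n, f v = if v ∈ W then 1 else 0

/-- Register `0` holds the number of vertices, memory `2` the positions of the rows of the adjacency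
matrix, and memory `3` the degrees. -/
structure HoldsGraph (G : SimpleGraph ℕ) [DecidableRel G.Adj] (n : ℕ) (s : Store) : Prop where
  reg_zero : s.reg 0 = n
  adj : ∀ u < n, ∀ v < n, s.mem 0 (s.mem 2 u + v) = if G.Adj u v then 1 else 0
  deg : ∀ v < n, s.mem 3 v = G.nbCount v (Finset.range n)

theorem HoldsGraph.congr {G : SimpleGraph ℕ} [DecidableRel G.Adj] {n : ℕ} {s s' : Store}
    (h : HoldsGraph G n s) (h0 : s'.reg 0 = s.reg 0) (hm0 : s'.mem 0 = s.mem 0)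
    (hm2 : s'.mem 2 = s.mem 2) (hm3 : s'.mem 3 = s.mem 3) : HoldsGraph G n s' :=
  ⟨h0.trans h.reg_zero, by rw [hm0, hm2]; exact h.adj, by rw [hm3]; exact h.deg⟩

theorem HoldsGraph.run {G : SimpleGraph ℕ} [DecidableRel G.Adj] {n : ℕ} {s : Store}
    (h : HoldsGraph G n s) {c : Cmd} (h0 : c.writes 0 = false) (hm0 : c.writesMem 0 = false)
    (hm2 : c.writesMem 2 = false) (hm3 : c.writesMem 3 = false) : HoldsGraph G n (c.run s) :=
  h.congr (Cmd.run_reg h0 s) (Cmd.run_mem hm0 s) (Cmd.run_mem hm2 s) (Cmd.run_mem hm3 s)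

/-- The entry of the adjacency matrix for the vertices in two registers. -/
def Expr.adj (u v : ℕ) : Expr := .load 0 (.add (.load 2 (.reg u)) (.reg v))

theorem HoldsGraph.eval_adj {G : SimpleGraph ℕ} [DecidableRel G.Adj] {n : ℕ} {s : Store}
    (h : HoldsGraph G n s) {u v a b : ℕ} (hu : s.reg u = a) (hv : s.reg v = b) (ha : a < n)
    (hb : b < n) : (Expr.adj u v).eval s = if G.Adj a b then 1 else 0 := by
  simp only [Expr.adj, Expr.eval, hu, hv, h.adj a ha b hb]

/-! ### The greedy procedure as a program -/

namespace Cmd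

/-- Choose the vertex in register `7`. -/
def greedyAdd (C : ℕ) : Cmd :=
  seq (store 4 (.reg 7) (.const 1)) (seq (assign 10 (.add (.reg 10) (.const 1)))
    (mapMem 8 C (.sub (.load C (.reg 8)) (.adj 7 8))))

/-- Choose the vertex in register `7` if its neighbours have free capacities. -/
def greedyTry (C : ℕ) : Cmd :=
  seq (sumIf 8 9 (.and (.adj 7 8) (.not (.load C (.reg 8)))) (.const 1))
    (cond (.reg 9) skip (greedyAdd C))

/-- One round of the greedy procedure. -/
def greedyStep (E C M : ℕ) : Cmd :=
  cond (.and (.load E (.reg 7)) (.and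
      (.eq (.add (.load 3 (.reg 7)) (.add (.reg 6) (.const 1))) (.reg 0))
      (.le (.add (.reg 10) (.const 1)) (.reg M))))
    (greedyTry C) skip

/-- The greedy procedure for the vertices in memory `E`, with the capacities in memory `C`, and at
most as many choices as register `M` tells. The choices are marked in memory `4`. -/
def greedy (E C M : ℕ) : Cmd := seq (assign 10 (.const 0)) (loop 6 (loop 7 (greedyStep E C M)))

variable {G : SimpleGraph ℕ} [DecidableRel G.Adj] {n : ℕ}

theorem run_greedyAdd {s : Store} (hG : HoldsGraph G n s) {W L : Finset ℕ} {cap : ℕ → ℕ} {C v : ℕ}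
    (hC : 8 ≤ C) (hv : s.reg 7 = v) (hvn : v < n) (hz : s.reg 10 = L.card) (hvL : v ∉ L)
    (hW : Indicates n (s.mem 4) (W ∪ L))
    (hcap : ∀ x < n, s.mem C x = cap x - G.nbCount x L) :
    ((greedyAdd C).run s).reg 10 = (insert v L).card ∧
    Indicates n (((greedyAdd C).run s).mem 4) (W ∪ insert v L) ∧
    ∀ x < n, ((greedyAdd C).run s).mem C x = cap x - G.nbCount x (insert v L) := by
  have hrun : (greedyAdd C).run s = (mapMem 8 C (.sub (.load C (.reg 8)) (.adj 7 8))).run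
      ((assign 10 (.add (.reg 10) (.const 1))).run ((store 4 (.reg 7) (.const 1)).run s)) := rfl
  rw [hrun]
  refine ⟨?_, ?_, ?_⟩
  · rw [run_reg (by simp [mapMem, writes])]
    simp [run, Store.setReg, Store.setMem, Expr.eval, hz, Finset.card_insert_of_notMem hvL]
  · rw [run_mem (by simp [mapMem, writesMem]; omega)]
    intro x hx
    simp only [run, Store.setReg, Store.setMem, Expr.eval, Function.update_self, hv]
    by_cases hxv : x = v
    · simp [hxv]
    · rw [Function.update_of_ne hxv, hW x hx]
      simp [hxv]
  · set s₁ := (assign 10 (.add (.reg 10) (.const 1))).run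
      ((store 4 (.reg 7) (.const 1)).run s) with hs₁
    have hn : s₁.reg 0 = n := by rw [← hG.reg_zero]; rfl
    have hG₁ : HoldsGraph G n s₁ := (hG.run rfl rfl rfl rfl).run rfl rfl rfl rfl
    have h7 : s₁.reg 7 = v := by rw [← hv]; rfl
    have hC₁ : s₁.mem C = s.mem C := by
      simp [hs₁, run, Store.setReg, Store.setMem, show C ≠ 4 by omega]
    rw [← hn]
    refine run_mapMem _ fun j hj s' hj' hreg hmem hcell => ?_
    rw [hn] at hj
    have hG' : HoldsGraph G n s' := hG₁.congr (hreg _ (by omega)) (hmem _ (by omega))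
      (hmem _ (by omega)) (hmem _ (by omega))
    rw [Expr.eval, hG'.eval_adj ((hreg 7 (by omega)).trans h7) hj' hvn hj,
      SimpleGraph.nbCount_insert hvL]
    simp only [Expr.eval, hj', hcell, hC₁, hcap j hj, G.adj_comm v j]
    omega

/-- The store represents the state `L` of the greedy procedure that was started with the marked
vertices `W`. -/
structure HoldsGreedy (G : SimpleGraph ℕ) [DecidableRel G.Adj] (n : ℕ) (E : Finset ℕ)
    (cap : ℕ → ℕ) (m i v : ℕ) (W : Finset ℕ) (C : ℕ) (s : Store) (L : Finset ℕ) : Prop where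
  inv : G.GreedyPartial n E (fun u => G.nbCount u (Finset.range n)) cap m i v L
  card : s.reg 10 = L.card
  marked : Indicates n (s.mem 4) (W ∪ L)
  cap : ∀ x < n, s.mem C x = cap x - G.nbCount x L

theorem HoldsGreedy.congr {E : Finset ℕ} {cap : ℕ → ℕ} {m i v : ℕ} {W : Finset ℕ} {C : ℕ}
    {s s' : Store} {L : Finset ℕ} (h : HoldsGreedy G n E cap m i v W C s L)
    (h10 : s'.reg 10 = s.reg 10) (hm4 : s'.mem 4 = s.mem 4) (hC : s'.mem C = s.mem C) :
    HoldsGreedy G n E cap m i v W C s' L :=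
  ⟨h.inv, h10.trans h.card, hm4 ▸ h.marked, by rw [hC]; exact h.cap⟩

theorem run_greedyTry {s : Store} (hG : HoldsGraph G n s) {W L E : Finset ℕ} {cap : ℕ → ℕ}
    {C m i v : ℕ} (hC : 8 ≤ C) (hv : s.reg 7 = v) (hvn : v < n)
    (h : HoldsGreedy G n E cap m i v W C s L) (hvE : v ∈ E)
    (hd : G.nbCount v (Finset.range n) + i + 1 = n) (hm : L.card < m) :
    ∃ L', HoldsGreedy G n E cap m i (v + 1) W C ((greedyTry C).run s) L' := by
  rw [greedyTry, run]
  set c := sumIf 8 9 (.and (.adj 7 8) (.not (.load C (.reg 8)))) (.const 1) with hc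
  -- Memory `C` holds the remaining capacities, so register `9` counts the saturated neighbours of
  -- `v`.
  have h9 : (c.run s).reg 9 =
      ((Finset.range n).filter fun x => G.Adj v x ∧ cap x - G.nbCount x L = 0).card := by
    rw [Finset.card_eq_sum_ones, ← hG.reg_zero]
    refine run_sumIf (by omega) (by omega) _ _ fun j hj s' hj' hreg hmem => ⟨?_, fun _ => rfl⟩
    rw [hG.reg_zero] at hj
    have hG' : HoldsGraph G n s' := hG.congr (hreg _ (by omega) (by omega)) (by rw [hmem])
      (by rw [hmem]) (by rw [hmem])
    rw [Expr.eval_and (hG'.eval_adj ((hreg 7 (by omega) (by omega)).trans hv) hj' hvn hj)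
      (Expr.eval_not _ _)]
    simp [Expr.eval, hj', hmem, h.cap j hj]
  have h₁ : HoldsGreedy G n E cap m i v W C (c.run s) L := h.congr
    (run_reg (by simp [hc, sumIf, writes]) s) (run_mem (by simp [hc, sumIf, writesMem]) s)
    (run_mem (by simp [hc, sumIf, writesMem]) s)
  by_cases h0 : (c.run s).reg 9 = 0
  · refine ⟨insert v L, ?_⟩
    have hchoice : G.GreedyChoice n E (fun u => G.nbCount u (Finset.range n)) cap m i v L := by
      refine ⟨⟨hvE, hd, hm⟩, fun x hx hvx => ?_⟩
      rw [h9, Finset.card_eq_zero, Finset.filter_eq_empty_iff] at h0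
      by_contra hcon
      exact h0 (Finset.mem_range.2 hx) ⟨hvx, by omega⟩
    obtain ⟨h1, h2, h3⟩ := run_greedyAdd (s := c.run s)
      (hG.run (by simp [hc, sumIf, writes]) (by simp [hc, sumIf, writesMem])
        (by simp [hc, sumIf, writesMem]) (by simp [hc, sumIf, writesMem])) hC
      ((run_reg (by simp [hc, sumIf, writes]) s).trans hv) hvn h₁.card (h.inv.notMem hd)
      h₁.marked h₁.cap
    have hrun : (cond (.reg 9) skip (greedyAdd C)).run (c.run s) = (greedyAdd C).run (c.run s) := by
      simp [run, Expr.eval, h0]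
    rw [hrun]
    exact ⟨h.inv.choose hchoice, h1, h2, h3⟩
  · refine ⟨L, ?_⟩
    have hrun : (cond (.reg 9) skip (greedyAdd C)).run (c.run s) = c.run s := by
      simp [run, Expr.eval, h0]
    rw [hrun]
    refine ⟨h.inv.not_choose fun hch => h0 ?_, h₁.card, h₁.marked, h₁.cap⟩
    rw [h9, Finset.card_eq_zero, Finset.filter_eq_empty_iff]
    rintro x hx ⟨hvx, hx0⟩
    have := hch.2 x (Finset.mem_range.1 hx) hvx
    omega

theorem run_greedyStep {s : Store} (hG : HoldsGraph G n s) {W L E : Finset ℕ} {cap : ℕ → ℕ}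
    {eMem C M m i v : ℕ} (hC : 8 ≤ C) (hv : s.reg 7 = v) (hvn : v < n) (hi : s.reg 6 = i)
    (hE : Indicates n (s.mem eMem) E) (hM : s.reg M = m)
    (h : HoldsGreedy G n E cap m i v W C s L) :
    ∃ L', HoldsGreedy G n E cap m i (v + 1) W C ((greedyStep eMem C M).run s) L' := by
  have hcond : (Expr.and (.load eMem (.reg 7)) (.and
      (.eq (.add (.load 3 (.reg 7)) (.add (.reg 6) (.const 1))) (.reg 0))
      (.le (.add (.reg 10) (.const 1)) (.reg M)))).eval s = if v ∈ E ∧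
        (G.nbCount v (Finset.range n) + (i + 1) = n ∧ L.card + 1 ≤ m) then 1 else 0 := by
    refine Expr.eval_and ?_ (Expr.eval_and ?_ ?_)
    · simp only [Expr.eval, hv]
      exact hE v hvn
    · simp only [Expr.eval_eq, Expr.eval, hv, hG.deg v hvn, hi, hG.reg_zero]
    · simp only [Expr.eval_le, Expr.eval, h.card, hM]
  rw [greedyStep, run, hcond]
  by_cases hc : v ∈ E ∧ (G.nbCount v (Finset.range n) + (i + 1) = n ∧ L.card + 1 ≤ m)
  · rw [if_pos hc, if_pos one_ne_zero]
    exact run_greedyTry hG hC hv hvn h hc.1 hc.2.1 hc.2.2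
  · rw [if_neg hc, if_neg (not_not.2 rfl)]
    exact ⟨L, h.inv.not_choose fun hch => hc ⟨hch.1.1, hch.1.2.1, hch.1.2.2⟩, h.card, h.marked,
      h.cap⟩

theorem greedy_writes {eMem C M r : ℕ} (h : r < 6 ∨ 10 < r) :
    (greedy eMem C M).writes r = false := by
  simp [greedy, greedyStep, greedyTry, greedyAdd, mapMem, sumIf, writes]
  omega

theorem greedy_writesMem {eMem C M a : ℕ} (h4 : a ≠ 4) (hC : a ≠ C) :
    (greedy eMem C M).writesMem a = false := by
  simp [greedy, greedyStep, greedyTry, greedyAdd, mapMem, sumIf, writesMem, h4, hC]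

/-- The greedy procedure computes a greedy set. -/
theorem run_greedy {s : Store} (hG : HoldsGraph G n s) {W E : Finset ℕ} {cap : ℕ → ℕ}
    {eMem C M m : ℕ} (hC : 8 ≤ C) (he : eMem ≠ 4) (heC : eMem ≠ C) (hMr : 10 < M)
    (hW : Indicates n (s.mem 4) W) (hE : Indicates n (s.mem eMem) E) (hEn : ∀ u ∈ E, u < n)
    (hcap : ∀ x < n, s.mem C x = cap x) (hM : s.reg M = m) :
    ∃ L, G.GreedySet (Finset.range n) E (fun u => G.nbCount u (Finset.range n)) cap m L ∧
      Indicates n (((greedy eMem C M).run s).mem 4) (W ∪ L) ∧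
      ∀ x < n, ((greedy eMem C M).run s).mem C x = cap x - G.nbCount x L := by
  set s₁ := (assign 10 (.const 0)).run s with hs₁
  have hn : s₁.reg 0 = n := by rw [← hG.reg_zero]; rfl
  have hM₁ : s₁.reg M = m := by
    rw [← hM]; simp [hs₁, run, Store.setReg, show M ≠ 10 by omega]
  have hG₁ : HoldsGraph G n s₁ := hG.run rfl rfl rfl rfl
  have hstepw : ∀ r, (r < 7 ∨ 10 < r) → (greedyStep eMem C M).writes r = false := fun r hr => by
    simp [greedyStep, greedyTry, greedyAdd, mapMem, sumIf, writes]
    omega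
  have hstepm : ∀ a, a ≠ 4 → a ≠ C → (greedyStep eMem C M).writesMem a = false := fun a h4 hC => by
    simp [greedyStep, greedyTry, greedyAdd, mapMem, sumIf, writesMem, h4, hC]
  have houter := run_loop (i := 6) (P := loop 7 (greedyStep eMem C M)) (s := s₁)
    (fun i s' => ∃ L, HoldsGreedy G n E cap m i 0 W C s' L) ?_ ?_
  · obtain ⟨L, h⟩ := houter
    rw [hn] at h
    exact ⟨L, h.inv.greedySet, h.marked, h.cap⟩
  · refine ⟨∅, .empty fun u hu => ?_, rfl, by rw [Finset.union_empty]; exact hW, fun x hx => ?_⟩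
    -- A vertex is not its own neighbour, so degrees are less than `n` and no vertex counts as
    -- processed at the start.
    · have : ((Finset.range n).filter (G.Adj u)).card < (Finset.range n).card :=
        Finset.card_lt_card (Finset.filter_ssubset.2 ⟨u, Finset.mem_range.2 (hEn u hu), by simp⟩)
      rwa [Finset.card_range] at this
    · rw [show G.nbCount x ∅ = 0 by simp [SimpleGraph.nbCount], Nat.sub_zero]
      exact hcap x hx
  · intro i hi s₂ hi₂ hreg hmem ⟨L, hL⟩
    have hreg' : ∀ r, r ≠ 6 → (r < 7 ∨ 10 < r) → r ≠ 7 → s₂.reg r = s₁.reg r := fun r h6 h h7 =>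
      hreg r h6 (by simp [writes, hstepw r h, h7])
    have hG₂ : HoldsGraph G n s₂ := hG₁.congr (hreg' _ (by omega) (by omega) (by omega))
      (hmem _ (hstepm _ (by omega) (by omega))) (hmem _ (hstepm _ (by omega) (by omega)))
      (hmem _ (hstepm _ (by omega) (by omega)))
    have hn₂ := hG₂.reg_zero
    have hinner := run_loop (i := 7) (P := greedyStep eMem C M) (s := s₂)
      (fun v s' => ∃ L, HoldsGreedy G n E cap m i v W C s' L) ⟨L, hL.congr rfl rfl rfl⟩ ?_
    · rw [hn₂] at hinner
      obtain ⟨L', hL'⟩ := hinner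
      exact ⟨L', hL'.inv.next_row hEn, hL'.card, hL'.marked, hL'.cap⟩
    intro v hv s₃ hv₃ hreg₃ hmem₃ ⟨L', hL'⟩
    have hG₃ : HoldsGraph G n s₃ := hG₂.congr (hreg₃ _ (by omega) (hstepw _ (by omega)))
      (hmem₃ _ (hstepm _ (by omega) (by omega))) (hmem₃ _ (hstepm _ (by omega) (by omega)))
      (hmem₃ _ (hstepm _ (by omega) (by omega)))
    obtain ⟨L'', hL''⟩ := run_greedyStep (eMem := eMem) (M := M) hG₃ hC hv₃ (by omega)
      ((hreg₃ 6 (by omega) (hstepw _ (by omega))).trans hi₂)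
      (by rw [hmem₃ _ (hstepm _ he heC), hmem _ (hstepm _ he heC)]; exact hE)
      (by rw [hreg₃ M (by omega) (hstepw _ (by omega)),
        hreg' M (by omega) (by omega) (by omega), hM₁]) hL'
    exact ⟨L'', hL''.congr rfl rfl rfl⟩

end Cmd

/-! ### Computing a representative set -/

namespace Cmd

variable {G : SimpleGraph ℕ} [DecidableRel G.Adj] {n : ℕ}

/-- A loop that marks further vertices in memory `4` for every `x` with the property `hub`. -/
theorem run_markLoop {r q : ℕ} {test : Expr} {P : Cmd} {s : Store} {hub : ℕ → Prop}
    [DecidablePred hub] {Q : ℕ → Finset ℕ → Prop} {E W : Finset ℕ} (hn : s.reg 0 = n)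
    (hQ : ∀ x W W', W ⊆ W' → Q x W → Q x W') (hWE : W ⊆ E) (hW : Indicates n (s.mem 4) W)
    (hstep : ∀ x < n, ∀ s', s'.reg r = x →
      (∀ q, q ≠ r → P.writes q = false → s'.reg q = s.reg q) →
      (∀ a, P.writesMem a = false → s'.mem a = s.mem a) →
      (test.eval s' = 0 ↔ hub x) ∧
      (hub x → ∀ W' ⊆ E, Indicates n (s'.mem 4) W' → ∃ W'' ⊆ E, W' ⊆ W'' ∧
        W''.card ≤ W'.card + q ∧ Q x W'' ∧ Indicates n ((P.run s').mem 4) W'')) :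
    ∃ W' ⊆ E, W ⊆ W' ∧ W'.card ≤ W.card + ((Finset.range n).filter hub).card * q ∧
      (∀ x ∈ Finset.range n, hub x → Q x W') ∧
      Indicates n (((loop r (cond test skip P)).run s).mem 4) W' := by
  have := run_loop (i := r) (P := cond test skip P) (s := s)
    (fun j s' => ∃ W' ⊆ E, W ⊆ W' ∧ W'.card ≤ W.card + ((Finset.range j).filter hub).card * q ∧
      (∀ x ∈ Finset.range j, hub x → Q x W') ∧ Indicates n (s'.mem 4) W')
    ⟨W, hWE, subset_rfl, by simp, by simp, hW⟩ ?_
  · rwa [hn] at this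
  rintro j hj s' hj' hreg hmem ⟨W', hWE', hWW', hc, hq, hI⟩
  obtain ⟨ht, hs⟩ := hstep j (hn ▸ hj) s' hj' (fun q hq h => hreg q hq (by simp [writes, h]))
    (fun a h => hmem a (by simp [writesMem, h]))
  rw [run]
  by_cases hub_j : hub j
  · obtain ⟨W'', h1, h2, h3, h4, h5⟩ := hs hub_j W' hWE' hI
    rw [if_neg (not_not.2 (ht.2 hub_j))]
    refine ⟨W'', h1, hWW'.trans h2, ?_, fun x hx hxh => ?_, h5⟩
    · rw [Finset.range_add_one, Finset.filter_insert, if_pos hub_j,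
        Finset.card_insert_of_notMem (by simp), Nat.succ_mul]
      omega
    · rw [Finset.range_add_one, Finset.mem_insert] at hx
      rcases hx with rfl | hx
      · exact h4
      -- Marks are never removed, so what was achieved for an earlier `x` persists.
      · exact hQ x _ _ h2 (hq x hx hxh)
  · rw [if_pos (mt ht.1 hub_j)]
    refine ⟨W', hWE', hWW', ?_, fun x hx hxh => ?_, hI⟩
    · rwa [Finset.range_add_one, Finset.filter_insert, if_neg hub_j]
    · rw [Finset.range_add_one, Finset.mem_insert] at hx
      rcases hx with rfl | hx
      · exact absurd hxh hub_j
      · exact hq x hx hxh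

/-- Mark in memory `e'` the neighbours of the vertex in register `r` among those marked in
memory `e`. -/
def restrict (e e' r : ℕ) : Cmd := mapMem 8 e' (.and (.load e (.reg 8)) (.adj r 8))

theorem run_restrict {s : Store} (hG : HoldsGraph G n s) {e e' r b : ℕ} {E : Finset ℕ}
    (hE : Indicates n (s.mem e) E) (he : e ≠ e') (he' : 3 < e') (hr : r ≠ 8) (hb : s.reg r = b)
    (hbn : b < n) : Indicates n (((restrict e e' r).run s).mem e') (E.filter (G.Adj b)) := by
  intro v hv
  rw [← hG.reg_zero] at hv
  revert v
  refine run_mapMem _ fun j hj s' hj' hreg hmem _ => ?_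
  rw [hG.reg_zero] at hj
  have hG' : HoldsGraph G n s' := hG.congr (hreg _ (by omega)) (hmem _ (by omega))
    (hmem _ (by omega)) (hmem _ (by omega))
  rw [Expr.eval_and (p := j ∈ E) (by simp only [Expr.eval, hj', hmem e he]; exact hE j hj)
    (hG'.eval_adj ((hreg r hr).trans hb) hj' hbn hj)]
  simp only [Finset.mem_filter]

/-- Initialize the capacities for the two common neighbours in registers `4` and `5`, and the
candidates, and run the greedy procedure. -/
def markTwo : Cmd :=
  seq (restrict 6 7 5) (seq (mapMem 8 10 (.const 3))
    (seq (store 10 (.reg 4) (.add (.reg 13) (.const 1)))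
      (seq (store 10 (.reg 5) (.add (.reg 13) (.const 1))) (greedy 7 10 13))))

/-- The same for one common neighbour in register `4`, followed by all second ones. -/
def markOne : Cmd :=
  seq (restrict 5 6 4) (seq (mapMem 8 9 (.reg 15))
    (seq (store 9 (.reg 4) (.add (.reg 12) (.const 1)))
      (seq (greedy 6 9 12) (loop 5 (cond (.load 9 (.reg 5)) skip markTwo)))))

/-- Mark a representative set in memory `4`. -/
def markAll : Cmd :=
  seq (mapMem 8 5 (.le (.reg 3) (.add (.load 3 (.reg 8)) (.reg 1))))
    (seq (mapMem 8 8 (.reg 14))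
      (seq (greedy 5 8 11) (loop 4 (cond (.load 8 (.reg 4)) skip markOne))))

theorem markTwo_writes {r : ℕ} (h : r < 6 ∨ 10 < r) : markTwo.writes r = false := by
  simp [markTwo, restrict, mapMem, writes, greedy_writes h]
  omega

theorem markTwo_writesMem {a : ℕ} (h4 : a ≠ 4) (h7 : a ≠ 7) (h10 : a ≠ 10) :
    markTwo.writesMem a = false := by
  simp [markTwo, restrict, mapMem, writesMem, greedy_writesMem h4 h10, h7, h10]

theorem markOne_writes {r : ℕ} (h : r < 5 ∨ 10 < r) : markOne.writes r = false := by
  simp [markOne, restrict, mapMem, writes, greedy_writes (show r < 6 ∨ 10 < r by omega),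
    markTwo_writes (show r < 6 ∨ 10 < r by omega)]
  omega

theorem markOne_writesMem {a : ℕ} (h4 : a ≠ 4) (h6 : a ≠ 6) (h7 : a ≠ 7) (h9 : a ≠ 9)
    (h10 : a ≠ 10) : markOne.writesMem a = false := by
  simp [markOne, restrict, mapMem, writesMem, greedy_writesMem h4 h9,
    markTwo_writesMem h4 h7 h10, h6, h9]

theorem markAll_writes {r : ℕ} (h : r < 4 ∨ 10 < r) : markAll.writes r = false := by
  simp [markAll, mapMem, writes, greedy_writes (show r < 6 ∨ 10 < r by omega),
    markOne_writes (show r < 5 ∨ 10 < r by omega)]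
  omega

theorem markAll_writesMem {a : ℕ} (h : a < 4) : markAll.writesMem a = false := by
  simp [markAll, mapMem, writesMem, greedy_writesMem (show a ≠ 4 by omega) (show a ≠ 8 by omega),
    markOne_writesMem (a := a) (by omega) (by omega) (by omega) (by omega) (by omega)]
  omega

theorem run_markTwo {s : Store} (hG : HoldsGraph G n s) {b c m : ℕ} {E W : Finset ℕ}
    (hb : s.reg 4 = b) (hc : s.reg 5 = c) (hcn : c < n) (hm : s.reg 13 = m)
    (hE : Indicates n (s.mem 6) E) (hEn : ∀ u ∈ E, u < n) (hW : Indicates n (s.mem 4) W) :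
    ∃ L, G.GreedySet (Finset.range n) (E.filter (G.Adj c))
        (fun u => G.nbCount u (Finset.range n)) (SimpleGraph.capOutside {b, c} 3 m) m L ∧
      Indicates n ((markTwo.run s).mem 4) (W ∪ L) := by
  set s₁ := (restrict 6 7 5).run s with hs₁
  set s₂ := (mapMem 8 10 (.const 3)).run s₁ with hs₂
  set s₃ := (store 10 (.reg 4) (.add (.reg 13) (.const 1))).run s₂ with hs₃
  set s₄ := (store 10 (.reg 5) (.add (.reg 13) (.const 1))).run s₃ with hs₄
  have hrun : markTwo.run s = (greedy 7 10 13).run s₄ := rfl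
  have hreg : ∀ r, r ≠ 8 → s₄.reg r = s.reg r := fun r hr => by
    rw [hs₄, run_reg rfl, hs₃, run_reg rfl, hs₂, run_reg (by simp [mapMem, writes, hr]), hs₁,
      run_reg (by simp [restrict, mapMem, writes, hr])]
  have hmem : ∀ a, a ≠ 10 → s₄.mem a = s₁.mem a := fun a ha => by
    rw [hs₄, run_mem (by simp [writesMem, ha]), hs₃, run_mem (by simp [writesMem, ha]), hs₂,
      run_mem (by simp [mapMem, writesMem, ha])]
  have hmem' : ∀ a, a ≠ 10 → a ≠ 7 → s₄.mem a = s.mem a := fun a ha ha' => by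
    rw [hmem a ha, hs₁, run_mem (by simp [restrict, mapMem, writesMem, ha'])]
  have hG₄ : HoldsGraph G n s₄ := hG.congr (hreg _ (by omega)) (hmem' _ (by omega) (by omega))
    (hmem' _ (by omega) (by omega)) (hmem' _ (by omega) (by omega))
  have hE₄ : Indicates n (s₄.mem 7) (E.filter (G.Adj c)) := by
    rw [hmem 7 (by omega)]
    exact run_restrict hG hE (by omega) (by omega) (by omega) hc hcn
  have hcap : ∀ x < n, s₄.mem 10 x = SimpleGraph.capOutside {b, c} 3 m x := by
    intro x hx
    have h2 : s₂.mem 10 x = 3 := by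
      refine run_mapMem (s := s₁) (fun _ => 3) (fun _ _ _ _ _ _ _ => rfl) x ?_
      rw [hs₁, run_reg (by rfl), hG.reg_zero]
      exact hx
    have h24 : s₂.reg 4 = b := by rw [← hb, hs₂, run_reg rfl, hs₁, run_reg rfl]
    have h25 : s₂.reg 5 = c := by rw [← hc, hs₂, run_reg rfl, hs₁, run_reg rfl]
    have h213 : s₂.reg 13 = m := by rw [← hm, hs₂, run_reg rfl, hs₁, run_reg rfl]
    simp only [hs₄, hs₃, run, Store.setMem, Expr.eval, h24, h25, h213, Function.update_self,
      Function.update_apply, h2, SimpleGraph.capOutside, Finset.mem_insert, Finset.mem_singleton]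
    -- The two writes store the same value, so `b = c` needs no separate treatment.
    by_cases hxc : x = c <;> by_cases hxb : x = b <;> simp [hxc, hxb]
  obtain ⟨L, h1, h2, -⟩ := run_greedy (M := 13) hG₄ (by omega) (by omega) (by omega) (by omega)
    (by rw [hmem' 4 (by omega) (by omega)]; exact hW) hE₄
    (fun u hu => hEn u (Finset.mem_filter.1 hu).1) hcap ((hreg 13 (by omega)).trans hm)
  exact ⟨L, h1, by rw [hrun]; exact h2⟩

/-- The parameters of the greedy procedures are in their registers. -/
structure HoldsParams (k δ : ℕ) (s : Store) : Prop where
  reg_one : s.reg 1 = k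
  reg_three : s.reg 3 = δ
  reg_eleven : s.reg 11 = (66 * (k * k) + 1) * k
  reg_twelve : s.reg 12 = (12 * k + 1) * k
  reg_thirteen : s.reg 13 = 4 * k
  reg_fourteen : s.reg 14 = 66 * (k * k)
  reg_fifteen : s.reg 15 = 12 * k

theorem HoldsParams.congr {k δ : ℕ} {s s' : Store} (h : HoldsParams k δ s)
    (hr : ∀ r, r < 4 ∨ 10 < r → s'.reg r = s.reg r) : HoldsParams k δ s' :=
  ⟨(hr _ (by omega)).trans h.1, (hr _ (by omega)).trans h.2, (hr _ (by omega)).trans h.3,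
    (hr _ (by omega)).trans h.4, (hr _ (by omega)).trans h.5, (hr _ (by omega)).trans h.6,
    (hr _ (by omega)).trans h.7⟩

theorem union_card_le {W L : Finset ℕ} {m : ℕ} (h : L.card ≤ m) : (W ∪ L).card ≤ W.card + m :=
  (Finset.card_union_le _ _).trans (Nat.add_le_add_left h _)

/-- After the greedy run, the zeros of memory `9` are the saturated vertices. `markTwo` changes
neither memory `9` nor the candidates in memory `6`, so the loop keeps reading them. Fewer than `4 *
k` rounds mark anything, at most `4 * k` vertices each. -/
theorem run_markOne (hK : G.K33Free) {s : Store} (hG : HoldsGraph G n s) {b k δ : ℕ}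
    (hk : 0 < k) (hp : HoldsParams k δ s) {E W : Finset ℕ} (hb : s.reg 4 = b) (hbn : b < n)
    (hE : Indicates n (s.mem 5) E) (hEn : ∀ u ∈ E, u < n) (hWE : W ⊆ E)
    (hW : Indicates n (s.mem 4) W) :
    ∃ W' ⊆ E, W ⊆ W' ∧ W'.card ≤ W.card + ((12 * k + 1) * k + 4 * k * (4 * k)) ∧
      (∃ L₁ ⊆ W', G.GreedySet (Finset.range n) (E.filter (G.Adj b))
        (fun u => G.nbCount u (Finset.range n))
        (SimpleGraph.capOutside {b} (12 * k) ((12 * k + 1) * k)) ((12 * k + 1) * k) L₁ ∧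
        ∀ c ∈ Finset.range n, G.nbCount c L₁ =
          SimpleGraph.capOutside {b} (12 * k) ((12 * k + 1) * k) c →
        ∃ L₂ ⊆ W', G.GreedySet (Finset.range n) ((E.filter (G.Adj b)).filter (G.Adj c))
          (fun u => G.nbCount u (Finset.range n))
          (SimpleGraph.capOutside {b, c} 3 (4 * k)) (4 * k) L₂) ∧
      Indicates n ((markOne.run s).mem 4) W' := by
  set s₁ := (restrict 5 6 4).run s with hs₁
  set s₂ := (mapMem 8 9 (.reg 15)).run s₁ with hs₂
  set s₃ := (store 9 (.reg 4) (.add (.reg 12) (.const 1))).run s₂ with hs₃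
  set s₄ := (greedy 6 9 12).run s₃ with hs₄
  have hrun : markOne.run s = (loop 5 (cond (.load 9 (.reg 5)) skip markTwo)).run s₄ := rfl
  have hreg : ∀ r, r ≠ 8 → s₃.reg r = s.reg r := fun r hr => by
    rw [hs₃, run_reg rfl, hs₂, run_reg (by simp [mapMem, writes, hr]), hs₁,
      run_reg (by simp [restrict, mapMem, writes, hr])]
  have hmem : ∀ a, a ≠ 9 → s₃.mem a = s₁.mem a := fun a ha => by
    rw [hs₃, run_mem (by simp [writesMem, ha]), hs₂, run_mem (by simp [mapMem, writesMem, ha])]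
  have hmem' : ∀ a, a ≠ 9 → a ≠ 6 → s₃.mem a = s.mem a := fun a ha ha' => by
    rw [hmem a ha, hs₁, run_mem (by simp [restrict, mapMem, writesMem, ha'])]
  have hG₃ : HoldsGraph G n s₃ := hG.congr (hreg _ (by omega)) (hmem' _ (by omega) (by omega))
    (hmem' _ (by omega) (by omega)) (hmem' _ (by omega) (by omega))
  have hE₃ : Indicates n (s₃.mem 6) (E.filter (G.Adj b)) := by
    rw [hmem 6 (by omega)]
    exact run_restrict hG hE (by omega) (by omega) (by omega) hb hbn
  have hcap : ∀ x < n, s₃.mem 9 x =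
      SimpleGraph.capOutside {b} (12 * k) ((12 * k + 1) * k) x := by
    intro x hx
    have h2 : s₂.mem 9 x = 12 * k := by
      refine run_mapMem (s := s₁) (fun _ => 12 * k) (fun j _ s' _ hr _ _ => ?_) x ?_
      · rw [← hp.reg_fifteen, Expr.eval, hr 15 (by omega), hs₁, run_reg rfl]
      · rw [hs₁, run_reg (by rfl), hG.reg_zero]
        exact hx
    have h24 : s₂.reg 4 = b := by rw [← hb, hs₂, run_reg rfl, hs₁, run_reg rfl]
    have h212 : s₂.reg 12 = (12 * k + 1) * k := by
      rw [← hp.reg_twelve, hs₂, run_reg rfl, hs₁, run_reg rfl]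
    simp only [hs₃, run, Store.setMem, Expr.eval, h24, h212, Function.update_self,
      Function.update_apply, h2, SimpleGraph.capOutside, Finset.mem_singleton]
  obtain ⟨L, h1, h2, h3⟩ := run_greedy (M := 12) hG₃ (by omega) (by omega) (by omega) (by omega)
    (by rw [hmem' 4 (by omega) (by omega)]; exact hW) hE₃
    (fun u hu => hEn u (Finset.mem_filter.1 hu).1) hcap ((hreg 12 (by omega)).trans hp.reg_twelve)
  have hreg₄ : ∀ r, r < 6 ∨ 10 < r → s₄.reg r = s.reg r := fun r hr => by
    rw [hs₄, run_reg (greedy_writes hr), hreg r (by omega)]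
  have hmem₄ : ∀ a, a ≠ 9 → a ≠ 4 → s₄.mem a = s₃.mem a := fun a h9 h4 => by
    rw [hs₄, run_mem (greedy_writesMem h4 h9)]
  have hG₄ : HoldsGraph G n s₄ := hG₃.run (greedy_writes (by omega))
    (greedy_writesMem (by omega) (by omega)) (greedy_writesMem (by omega) (by omega))
    (greedy_writesMem (by omega) (by omega))
  have hLE : L ⊆ E := h1.subset.trans (Finset.filter_subset _ _)
  have hloop := run_markLoop (r := 5) (P := markTwo) (s := s₄)
    (test := .load 9 (.reg 5)) (q := 4 * k) (W := W ∪ L) (E := E)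
    (hub := fun c => G.nbCount c L = SimpleGraph.capOutside {b} (12 * k) ((12 * k + 1) * k) c)
    (Q := fun c W' => ∃ L₂ ⊆ W',
      G.GreedySet (Finset.range n) ((E.filter (G.Adj b)).filter (G.Adj c))
          (fun u => G.nbCount u (Finset.range n))
          (SimpleGraph.capOutside {b, c} 3 (4 * k)) (4 * k) L₂)
    hG₄.reg_zero (fun x W W' h ⟨L, hL, hg⟩ => ⟨L, hL.trans h, hg⟩)
    (Finset.union_subset hWE hLE) h2 ?_
  · obtain ⟨W', hW'E, hWW', hcard, hQ, hI⟩ := hloop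
    refine ⟨W', hW'E, Finset.subset_union_left.trans hWW', ?_,
      ⟨L, Finset.subset_union_right.trans hWW', h1, hQ⟩, by rw [hrun]; exact hI⟩
    have hh := Nat.mul_le_mul_right (4 * k) (h1.card_hubs_lt_one hK hk).le
    have := union_card_le (W := W) h1.card_le
    omega
  · intro c hc s₅ hc₅ hreg₅ hmem₅
    have hm9 : s₅.mem 9 = s₄.mem 9 :=
      hmem₅ 9 (markTwo_writesMem (by omega) (by omega) (by omega))
    refine ⟨?_, fun hhub W' hW'E hW' => ?_⟩
    · have := h1.nbCount_le c (Finset.mem_range.2 hc)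
      have := h3 c hc
      rw [← hs₄] at this
      simp only [Expr.eval, hc₅, hm9]
      omega
    · have hG₅ : HoldsGraph G n s₅ := hG₄.congr (hreg₅ _ (by omega) (markTwo_writes (by omega)))
        (hmem₅ _ (markTwo_writesMem (by omega) (by omega) (by omega)))
        (hmem₅ _ (markTwo_writesMem (by omega) (by omega) (by omega)))
        (hmem₅ _ (markTwo_writesMem (by omega) (by omega) (by omega)))
      obtain ⟨L₂, g1, g2⟩ := run_markTwo hG₅ (b := b) (m := 4 * k)
        (by rw [hreg₅ 4 (by omega) (markTwo_writes (by omega)), hreg₄ 4 (by omega), hb]) hc₅ hc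
        (by rw [hreg₅ 13 (by omega) (markTwo_writes (by omega)), hreg₄ 13 (by omega),
          hp.reg_thirteen])
        (by rw [hmem₅ 6 (markTwo_writesMem (by omega) (by omega) (by omega)),
          hmem₄ 6 (by omega) (by omega)]; exact hE₃)
        (fun u hu => hEn u (Finset.mem_filter.1 hu).1) hW'
      exact ⟨W' ∪ L₂, Finset.union_subset hW'E (g1.subset.trans
          ((Finset.filter_subset _ _).trans (Finset.filter_subset _ _))),
        Finset.subset_union_left, union_card_le g1.card_le,
        ⟨L₂, Finset.subset_union_right, g1⟩, g2⟩

/-- The program marks a representative set of size `O(k³)`. -/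
theorem run_markAll (hK : G.K33Free) {s : Store} (hG : HoldsGraph G n s) {k δ : ℕ}
    (hk : 0 < k) (hp : HoldsParams k δ s) (h0 : ∀ x < n, s.mem 4 x = 0) :
    ∃ W ⊆ (Finset.range n).filter fun v => δ ≤ G.nbCount v (Finset.range n) + k,
      W.card ≤ 183 * k ^ 3 ∧
      G.Representative (Finset.range n)
        ((Finset.range n).filter fun v => δ ≤ G.nbCount v (Finset.range n) + k)
        (fun v => G.nbCount v (Finset.range n)) k W ∧
      Indicates n ((markAll.run s).mem 4) W := by
  set E := (Finset.range n).filter fun v => δ ≤ G.nbCount v (Finset.range n) + k with hEdef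
  have hEn : ∀ u ∈ E, u < n := fun u hu => Finset.mem_range.1 (Finset.mem_filter.1 hu).1
  set s₁ := (mapMem 8 5 (.le (.reg 3) (.add (.load 3 (.reg 8)) (.reg 1)))).run s with hs₁
  set s₂ := (mapMem 8 8 (.reg 14)).run s₁ with hs₂
  set s₃ := (greedy 5 8 11).run s₂ with hs₃
  have hrun : markAll.run s = (loop 4 (cond (.load 8 (.reg 4)) skip markOne)).run s₃ := rfl
  have hreg : ∀ r, r ≠ 8 → s₂.reg r = s.reg r := fun r hr => by
    rw [hs₂, run_reg (by simp [mapMem, writes, hr]), hs₁,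
      run_reg (by simp [mapMem, writes, hr])]
  have hmem : ∀ a, a ≠ 8 → s₂.mem a = s₁.mem a := fun a ha => by
    rw [hs₂, run_mem (by simp [mapMem, writesMem, ha])]
  have hmem' : ∀ a, a ≠ 8 → a ≠ 5 → s₂.mem a = s.mem a := fun a ha ha' => by
    rw [hmem a ha, hs₁, run_mem (by simp [mapMem, writesMem, ha'])]
  have hG₂ : HoldsGraph G n s₂ := hG.congr (hreg _ (by omega)) (hmem' _ (by omega) (by omega))
    (hmem' _ (by omega) (by omega)) (hmem' _ (by omega) (by omega))
  have hE₂ : Indicates n (s₂.mem 5) E := by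
    rw [hmem 5 (by omega)]
    intro v hv
    rw [← hG.reg_zero] at hv
    revert v
    refine run_mapMem _ fun j hj s' hj' hr hm _ => ?_
    rw [hG.reg_zero] at hj
    rw [Expr.eval_le]
    simp only [Expr.eval, hj', hr 3 (by omega), hr 1 (by omega), hm 3 (by omega), hp.reg_one,
      hp.reg_three, hG.deg j hj, hEdef, Finset.mem_filter, Finset.mem_range, hj, true_and]
  have hcap : ∀ x < n, s₂.mem 8 x =
      SimpleGraph.capOutside ∅ (66 * (k * k)) ((66 * (k * k) + 1) * k) x := by
    intro x hx
    have h2 : s₂.mem 8 x = 66 * (k * k) := by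
      refine run_mapMem (s := s₁) (fun _ => 66 * (k * k)) (fun j _ s' _ hr _ _ => ?_) x ?_
      · rw [← hp.reg_fourteen, Expr.eval, hr 14 (by omega), hs₁, run_reg rfl]
      · rw [hs₁, run_reg (by rfl), hG.reg_zero]
        exact hx
    simp [h2, SimpleGraph.capOutside]
  obtain ⟨L, h1, h2, h3⟩ := run_greedy (M := 11) (W := ∅) hG₂ (by omega) (by omega) (by omega)
    (by omega) (by rw [hmem' 4 (by omega) (by omega)]; intro x hx; simpa using h0 x hx) hE₂
    hEn hcap ((hreg 11 (by omega)).trans hp.reg_eleven)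
  rw [Finset.empty_union] at h2
  have hreg₃ : ∀ r, r < 6 ∨ 10 < r → s₃.reg r = s.reg r := fun r hr => by
    rw [hs₃, run_reg (greedy_writes hr), hreg r (by omega)]
  have hmem₃ : ∀ a, a ≠ 8 → a ≠ 4 → s₃.mem a = s₂.mem a := fun a h8 h4 => by
    rw [hs₃, run_mem (greedy_writesMem h4 h8)]
  have hG₃ : HoldsGraph G n s₃ := hG₂.run (greedy_writes (by omega))
    (greedy_writesMem (by omega) (by omega)) (greedy_writesMem (by omega) (by omega))
    (greedy_writesMem (by omega) (by omega))
  have hloop := run_markLoop (r := 4) (P := markOne) (s := s₃)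
    (test := .load 8 (.reg 4)) (q := (12 * k + 1) * k + 4 * k * (4 * k)) (W := L) (E := E)
    (hub := fun b => G.nbCount b L =
      SimpleGraph.capOutside ∅ (66 * (k * k)) ((66 * (k * k) + 1) * k) b)
    (Q := fun b W' => ∃ L₁ ⊆ W', G.GreedySet (Finset.range n) (E.filter (G.Adj b))
        (fun u => G.nbCount u (Finset.range n))
        (SimpleGraph.capOutside {b} (12 * k) ((12 * k + 1) * k)) ((12 * k + 1) * k) L₁ ∧
        ∀ c ∈ Finset.range n, G.nbCount c L₁ =
          SimpleGraph.capOutside {b} (12 * k) ((12 * k + 1) * k) c →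
        ∃ L₂ ⊆ W', G.GreedySet (Finset.range n) ((E.filter (G.Adj b)).filter (G.Adj c))
          (fun u => G.nbCount u (Finset.range n))
          (SimpleGraph.capOutside {b, c} 3 (4 * k)) (4 * k) L₂)
    hG₃.reg_zero (fun x W W' h ⟨L, hL, hg, hc⟩ => ⟨L, hL.trans h, hg, fun c hc' hcc =>
      let ⟨L₂, hL₂, hg₂⟩ := hc c hc' hcc
      ⟨L₂, hL₂.trans h, hg₂⟩⟩)
    h1.subset h2 ?_
  · obtain ⟨W', hW'E, hWW', hcard, hQ, hI⟩ := hloop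
    refine ⟨W', hW'E, ?_, ⟨L, hWW', h1, hQ⟩, by rw [hrun]; exact hI⟩
    -- The total is at most `66 * k ^ 3 + k` from the first level plus `4 * k * (28 * k ^ 2 + k)`
    -- from the others, that is `178 * k ^ 3 + 4 * k ^ 2 + k`.
    have hh := Nat.mul_le_mul_right ((12 * k + 1) * k + 4 * k * (4 * k))
      (h1.card_hubs_lt_zero hK hk).le
    have hc := h1.card_le
    have hk1 : k ≤ k ^ 3 := Nat.le_self_pow (by norm_num) k
    have hk2 : k ^ 2 ≤ k ^ 3 := Nat.pow_le_pow_right hk (by norm_num)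
    ring_nf at hh hc hcard ⊢
    omega
  · intro b hb s₄ hb₄ hreg₄ hmem₄
    have hm8 : s₄.mem 8 = s₃.mem 8 :=
      hmem₄ 8 (markOne_writesMem (by omega) (by omega) (by omega) (by omega) (by omega))
    refine ⟨?_, fun hhub W' hW'E hW' => ?_⟩
    · have := h1.nbCount_le b (Finset.mem_range.2 hb)
      have := h3 b hb
      rw [← hs₃] at this
      simp only [Expr.eval, hb₄, hm8]
      omega
    · have hm : ∀ a, a < 4 → s₄.mem a = s₃.mem a := fun a ha => hmem₄ a
        (markOne_writesMem (by omega) (by omega) (by omega) (by omega) (by omega))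
      have hG₄ : HoldsGraph G n s₄ := hG₃.congr (hreg₄ _ (by omega) (markOne_writes (by omega)))
        (hm _ (by omega)) (hm _ (by omega)) (hm _ (by omega))
      exact run_markOne hK hG₄ hk (hp.congr fun r hr => by
          rw [hreg₄ r (by omega) (markOne_writes (by omega)), hreg₃ r (by omega)]) hb₄ hb
        (by rw [hmem₄ 5 (markOne_writesMem (by omega) (by omega) (by omega) (by omega) (by omega)),
          hmem₃ 5 (by omega) (by omega)]; exact hE₂) hEn hW'E hW'

end Cmd

/-! ### Reading the input -/

namespace Cmd

variable {G : SimpleGraph ℕ} [DecidableRel G.Adj] {n : ℕ}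

/-- Multiply by the number in register `1`, which must not exceed the one in register `0`. -/
def mulOne (r : ℕ) (e : Expr) : Cmd := sumIf 6 r (.sub (.reg 1) (.reg 6)) e

/-- The machine cannot multiply. The summand is added in the rounds `j < k`, and `k ≤ n` ensures
that all of them take place. -/
theorem run_mulOne {s : Store} {r k m : ℕ} {e : Expr} (hr : r ≠ 0) (hr6 : r ≠ 6) (hr1 : r ≠ 1)
    (hk : s.reg 1 = k) (hkn : k ≤ s.reg 0)
    (he : ∀ s' : Store, (∀ q, q ≠ 6 → q ≠ r → s'.reg q = s.reg q) → s'.mem = s.mem →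
      e.eval s' = m) : ((mulOne r e).run s).reg r = k * m := by
  rw [mulOne, run_sumIf hr hr6 (fun j => j < k) (fun _ => m), Finset.sum_const, smul_eq_mul]
  · congr 1
    have : (Finset.range (s.reg 0)).filter (fun j => j < k) = Finset.range k := by
      ext j; simp; omega
    rw [this, Finset.card_range]
  · intro j hj s' hj' hreg hmem
    refine ⟨?_, fun _ => he s' hreg hmem⟩
    simp only [Expr.eval, hreg 1 (by omega) (by omega), hj', hk]
    omega

/-- Store the positions of the rows of the adjacency matrix in memory `2`. -/
def rows : Cmd :=
  seq (assign 16 (.const 3)) (loop 6 (seq (store 2 (.reg 6) (.reg 16))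
    (assign 16 (.add (.reg 16) (.reg 0)))))

theorem run_rows {s : Store} (hn : s.reg 0 = n) :
    ∀ u < n, (rows.run s).mem 2 u = 3 + u * n := by
  have := run_loop (i := 6) (P := seq (store 2 (.reg 6) (.reg 16))
    (assign 16 (.add (.reg 16) (.reg 0)))) (s := s.setReg 16 3)
    (fun j s' => s'.reg 16 = 3 + j * n ∧ ∀ u < j, s'.mem 2 u = 3 + u * n)
    ⟨by simp [Store.setReg], by simp⟩ ?_
  · intro u hu
    exact this.2 u (by rw [← hn] at hu; exact hu)
  · rintro j hj s' hj' hreg - ⟨h1, h2⟩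
    have h0 : s'.reg 0 = n := by rw [hreg 0 (by omega) rfl, ← hn]; rfl
    refine ⟨?_, fun u hu => ?_⟩
    · simp [run, Store.setReg, Store.setMem, Expr.eval, h0, h1]
      ring
    · simp only [run, Store.setReg, Store.setMem, Expr.eval, hj', h1, Function.update_self,
        Function.update_apply]
      split_ifs with huj
      · rw [huj]
      · exact h2 u (by omega)

/-- Store the degrees in memory `3`. -/
def degrees : Cmd := loop 7 (seq (sumIf 8 9 (.adj 7 8) (.const 1)) (store 3 (.reg 7) (.reg 9)))

theorem run_degrees {s : Store} (hn : s.reg 0 = n)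
    (hadj : ∀ u < n, ∀ v < n, s.mem 0 (s.mem 2 u + v) = if G.Adj u v then 1 else 0) :
    ∀ v < n, (degrees.run s).mem 3 v = G.nbCount v (Finset.range n) := by
  have := run_loop (i := 7) (P := seq (sumIf 8 9 (.adj 7 8) (.const 1)) (store 3 (.reg 7) (.reg 9)))
    (s := s) (fun j s' => ∀ v < j, s'.mem 3 v = G.nbCount v (Finset.range n)) (by simp) ?_
  · rwa [hn] at this
  intro j hj s' hj' hreg hmem hI v hv
  rw [hn] at hj
  have h0 : s'.reg 0 = n := by rw [hreg 0 (by omega) rfl, hn]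
  set s₁ := (sumIf 8 9 (.adj 7 8) (.const 1)).run s' with hs₁
  have h9 : s₁.reg 9 = G.nbCount j (Finset.range n) := by
    rw [SimpleGraph.nbCount, Finset.card_eq_sum_ones, ← h0]
    refine run_sumIf (by omega) (by omega) _ _ fun x hx s₂ hx₂ hr₂ hm₂ => ⟨?_, fun _ => rfl⟩
    rw [h0] at hx
    simp only [Expr.adj, Expr.eval, hx₂, hr₂ 7 (by omega) (by omega), hj', hm₂, hmem 0 rfl,
      hmem 2 rfl, hadj j hj x hx]
    simp
  have h7 : s₁.reg 7 = j := by rw [← hj', hs₁, run_reg rfl]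
  have h3 : s₁.mem 3 = s'.mem 3 := by rw [hs₁, run_mem rfl]
  change (s₁.setMem 3 (s₁.reg 7) (s₁.reg 9)).mem 3 v = _
  simp only [Store.setMem, Function.update_self, h7, h9, Function.update_apply]
  split_ifs with hvj
  · rw [hvj]
  · rw [h3]; exact hI v (by omega)

/-- Compute the degree of the vertex of rank `k` in register `3`. -/
def rankDegree : Cmd :=
  seq (assign 3 (.const 0)) (loop 6 (seq (sumIf 8 9 (.le (.reg 6) (.load 3 (.reg 8))) (.const 1))
    (cond (.le (.reg 1) (.reg 9)) (assign 3 (.reg 6)) skip)))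

/-- Register `3` keeps the largest `j` tried so far such that at least `k` vertices have degree at
least `j`; the initial `0` qualifies because `k ≤ n`. -/
theorem run_rankDegree {s : Store} (hG : HoldsGraph G n s) {k : ℕ} (hk : s.reg 1 = k)
    (hk0 : 0 < k) (hkn : k ≤ n) :
    k ≤ ((Finset.range n).filter fun v =>
      (rankDegree.run s).reg 3 ≤ G.nbCount v (Finset.range n)).card ∧
    ((Finset.range n).filter fun v =>
      (rankDegree.run s).reg 3 < G.nbCount v (Finset.range n)).card < k := by
  have := run_loop (i := 6) (P := seq (sumIf 8 9 (.le (.reg 6) (.load 3 (.reg 8))) (.const 1))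
      (cond (.le (.reg 1) (.reg 9)) (assign 3 (.reg 6)) skip)) (s := s.setReg 3 0)
    (fun j s' => k ≤ ((Finset.range n).filter fun v =>
      s'.reg 3 ≤ G.nbCount v (Finset.range n)).card ∧
      ∀ i < j, k ≤ ((Finset.range n).filter fun v => i ≤ G.nbCount v (Finset.range n)).card →
        i ≤ s'.reg 3)
    ⟨by simpa [Store.setReg] using hkn, by simp⟩ ?_
  · obtain ⟨h1, h2⟩ := this
    have hrun : rankDegree.run s = (loop 6 (seq (sumIf 8 9 (.le (.reg 6) (.load 3 (.reg 8)))
      (.const 1)) (cond (.le (.reg 1) (.reg 9)) (assign 3 (.reg 6)) skip))).run (s.setReg 3 0) :=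
      rfl
    rw [← hrun, show (s.setReg 3 0).reg 0 = n from hG.reg_zero] at h2
    rw [← hrun] at h1
    refine ⟨h1, ?_⟩
    by_contra hcon
    rw [not_lt] at hcon
    -- The loop tries only values below `n`; larger ones are excluded because no degree reaches `n`.
    by_cases hlt : (rankDegree.run s).reg 3 + 1 < n
    · have := h2 _ hlt hcon
      omega
    · obtain ⟨v, hv⟩ := Finset.card_pos.1 (hk0.trans_le hcon)
      rw [Finset.mem_filter] at hv
      have : ((Finset.range n).filter (G.Adj v)).card < (Finset.range n).card :=
        Finset.card_lt_card (Finset.filter_ssubset.2 ⟨v, hv.1, by simp⟩)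
      rw [Finset.card_range] at this
      have h3 := hv.2
      unfold SimpleGraph.nbCount at h3
      omega
  · rintro j hj s' hj' hreg hmem ⟨h1, h2⟩
    have hG' : HoldsGraph G n s' := hG.congr (hreg 0 (by omega) rfl) (hmem 0 rfl) (hmem 2 rfl)
      (hmem 3 rfl)
    set s₁ := (sumIf 8 9 (.le (.reg 6) (.load 3 (.reg 8))) (.const 1)).run s' with hs₁
    have h9 : s₁.reg 9 =
        ((Finset.range n).filter fun v => j ≤ G.nbCount v (Finset.range n)).card := by
      rw [Finset.card_eq_sum_ones, ← hG'.reg_zero]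
      refine run_sumIf (by omega) (by omega) _ _ fun x hx s₂ hx₂ hr₂ hm₂ => ⟨?_, fun _ => rfl⟩
      rw [hG'.reg_zero] at hx ⊢
      rw [Expr.eval_le]
      simp only [Expr.eval, hx₂, hr₂ 6 (by omega) (by omega), hj', hm₂, hG'.deg x hx]
      simp
    have h6 : s₁.reg 6 = j := by rw [← hj', hs₁, run_reg rfl]
    have h3 : s₁.reg 3 = s'.reg 3 := by rw [hs₁, run_reg rfl]
    have hr1 : s₁.reg 1 = k := by
      rw [hs₁, run_reg rfl, hreg 1 (by omega) rfl, ← hk]; rfl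
    have hc : (Expr.le (.reg 1) (.reg 9)).eval s₁ = if k ≤ ((Finset.range n).filter fun v =>
        j ≤ G.nbCount v (Finset.range n)).card then 1 else 0 := by
      simp only [Expr.eval_le, Expr.eval, hr1, h9]
    have hrun : (((seq (sumIf 8 9 (.le (.reg 6) (.load 3 (.reg 8))) (.const 1))
        (cond (.le (.reg 1) (.reg 9)) (assign 3 (.reg 6)) skip)).run s').setReg 6 (j + 1)).reg 3 =
        if k ≤ ((Finset.range n).filter fun v => j ≤ G.nbCount v (Finset.range n)).card then j
          else s'.reg 3 := by
      change (((cond (.le (.reg 1) (.reg 9)) (assign 3 (.reg 6)) skip).run s₁).setReg 6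
        (j + 1)).reg 3 = _
      rw [run, hc]
      split_ifs <;> simp_all [run, Store.setReg, Expr.eval]
    rw [hrun]
    split_ifs with hif
    · exact ⟨hif, fun i hi _ => by omega⟩
    · refine ⟨h1, fun i hi hki => ?_⟩
      by_cases hij : i = j
      · subst hij; exact absurd hki hif
      · exact h2 i (by omega) hki

/-- Compute the parameters of the greedy procedures. -/
def params : Cmd :=
  seq (mulOne 16 (.reg 1)) (seq (assign 14 (.smul 66 (.reg 16)))
    (seq (assign 15 (.smul 12 (.reg 1))) (seq (assign 13 (.smul 4 (.reg 1)))
      (seq (mulOne 11 (.add (.reg 14) (.const 1))) (mulOne 12 (.add (.reg 15) (.const 1)))))))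

theorem run_params {s : Store} (hn : s.reg 0 = n) {k : ℕ} (hk : s.reg 1 = k) (hkn : k ≤ n) :
    HoldsParams k (s.reg 3) (params.run s) := by
  set s₁ := (mulOne 16 (.reg 1)).run s with hs₁
  set s₂ := (assign 14 (.smul 66 (.reg 16))).run s₁ with hs₂
  set s₃ := (assign 15 (.smul 12 (.reg 1))).run s₂ with hs₃
  set s₄ := (assign 13 (.smul 4 (.reg 1))).run s₃ with hs₄
  set s₅ := (mulOne 11 (.add (.reg 14) (.const 1))).run s₄ with hs₅
  have hrun : params.run s = (mulOne 12 (.add (.reg 15) (.const 1))).run s₅ := rfl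
  have h16 : s₁.reg 16 = k * k := run_mulOne (by omega) (by omega) (by omega) hk
    (by omega) fun s' hr _ => by rw [Expr.eval, hr 1 (by omega) (by omega), hk]
  have h1₁ : s₁.reg 1 = k := by rw [hs₁, run_reg rfl, hk]
  have h14₂ : s₂.reg 14 = 66 * (k * k) := by
    simp [hs₂, run, Store.setReg, Expr.eval_smul, Expr.eval, h16]
  have h1₂ : s₂.reg 1 = k := by rw [hs₂, run_reg rfl, h1₁]
  have h15₃ : s₃.reg 15 = 12 * k := by
    simp [hs₃, run, Store.setReg, Expr.eval_smul, Expr.eval, h1₂]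
  have h1₃ : s₃.reg 1 = k := by rw [hs₃, run_reg rfl, h1₂]
  have h13₄ : s₄.reg 13 = 4 * k := by
    simp [hs₄, run, Store.setReg, Expr.eval_smul, Expr.eval, h1₃]
  have h1₄ : s₄.reg 1 = k := by rw [hs₄, run_reg rfl, h1₃]
  have h14₄ : s₄.reg 14 = 66 * (k * k) := by rw [hs₄, run_reg rfl, hs₃, run_reg rfl, h14₂]
  have h15₄ : s₄.reg 15 = 12 * k := by rw [hs₄, run_reg rfl, h15₃]
  have h0₄ : s₄.reg 0 = n := by
    rw [hs₄, run_reg rfl, hs₃, run_reg rfl, hs₂, run_reg rfl, hs₁, run_reg rfl, hn]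
  have h11 : s₅.reg 11 = k * (66 * (k * k) + 1) := run_mulOne (by omega) (by omega) (by omega) h1₄
    (by omega) fun s' hr _ => by simp only [Expr.eval, hr 14 (by omega) (by omega), h14₄]
  have h1₅ : s₅.reg 1 = k := by rw [hs₅, run_reg rfl, h1₄]
  have h15₅ : s₅.reg 15 = 12 * k := by rw [hs₅, run_reg rfl, h15₄]
  have h0₅ : s₅.reg 0 = n := by rw [hs₅, run_reg rfl, h0₄]
  have h12 : (params.run s).reg 12 = k * (12 * k + 1) := by
    rw [hrun]
    exact run_mulOne (by omega) (by omega) (by omega) h1₅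
      (by omega) fun s' hr _ => by simp only [Expr.eval, hr 15 (by omega) (by omega), h15₅]
  refine ⟨?_, ?_, ?_, by rw [h12, mul_comm], ?_, ?_, ?_⟩
  · rw [hrun, run_reg rfl, h1₅]
  · rw [run_reg rfl]
  · rw [hrun, run_reg rfl, h11, mul_comm]
  · rw [hrun, run_reg rfl, hs₅, run_reg rfl, h13₄]
  · rw [hrun, run_reg rfl, hs₅, run_reg rfl, h14₄]
  · rw [hrun, run_reg rfl, h15₅]

/-- Everything that precedes the marking of vertices. -/
def setup : Cmd := seq rows (seq degrees (seq rankDegree params))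

theorem run_setup {s : Store} (hn : s.reg 0 = n) {k : ℕ} (hk : s.reg 1 = k)
    (hk0 : 0 < k) (hkn : k ≤ n)
    (hadj : ∀ u < n, ∀ v < n, s.mem 0 (3 + u * n + v) = if G.Adj u v then 1 else 0) :
    ∃ δ, HoldsGraph G n (setup.run s) ∧ HoldsParams k δ (setup.run s) ∧
      k ≤ ((Finset.range n).filter fun v => δ ≤ G.nbCount v (Finset.range n)).card ∧
      ((Finset.range n).filter fun v => δ < G.nbCount v (Finset.range n)).card < k := by
  set s₁ := rows.run s with hs₁
  set s₂ := degrees.run s₁ with hs₂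
  set s₃ := rankDegree.run s₂ with hs₃
  have hrun : setup.run s = params.run s₃ := rfl
  have hn₁ : s₁.reg 0 = n := by rw [hs₁, run_reg rfl, hn]
  have hadj₁ : ∀ u < n, ∀ v < n, s₁.mem 0 (s₁.mem 2 u + v) = if G.Adj u v then 1 else 0 := by
    intro u hu v hv
    rw [run_rows hn u hu, hs₁, run_mem rfl, hadj u hu v hv]
  have hG₂ : HoldsGraph G n s₂ := ⟨by rw [hs₂, run_reg rfl, hn₁],
    by rw [hs₂, run_mem (a := 0) rfl, run_mem (a := 2) rfl]; exact hadj₁, run_degrees hn₁ hadj₁⟩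
  have hk₂ : s₂.reg 1 = k := by rw [hs₂, run_reg rfl, hs₁, run_reg rfl, hk]
  have hG₃ : HoldsGraph G n s₃ := hG₂.run rfl rfl rfl rfl
  obtain ⟨h1, h2⟩ := run_rankDegree hG₂ hk₂ hk0 hkn
  exact ⟨s₃.reg 3, hG₃.run rfl rfl rfl rfl,
    run_params hG₃.reg_zero (by rw [hs₃, run_reg rfl, hk₂]) hkn, h1, h2⟩

/-! ### Writing the output -/

/-- The list `l` is in memory `1` and its length in register `24`. -/
def _root_.Store.Written (s : Store) (l : List ℕ) : Prop :=
  s.reg 24 = l.length ∧ ∀ i (h : i < l.length), s.mem 1 i = l[i]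

theorem _root_.Store.Written.congr {s s' : Store} {l : List ℕ} (h : s.Written l)
    (hr : s'.reg 24 = s.reg 24) (hm : s'.mem 1 = s.mem 1) : s'.Written l :=
  ⟨hr.trans h.1, hm ▸ h.2⟩

/-- Append a number to the output. -/
def push (e : Expr) : Cmd :=
  seq (store 1 (.reg 24) e) (assign 24 (.add (.reg 24) (.const 1)))

theorem run_push {s : Store} {l : List ℕ} (h : s.Written l) {e : Expr} {x : ℕ}
    (he : e.eval s = x) : ((push e).run s).Written (l ++ [x]) := by
  refine ⟨by simp [push, run, Store.setReg, Store.setMem, Expr.eval, h.1], fun i hi => ?_⟩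
  simp only [push, run, Store.setReg, Store.setMem, Expr.eval, h.1, he, Function.update_self,
    Function.update_apply, List.getElem_append]
  by_cases hil : i = l.length
  · simp [hil]
  · have hi' : i < l.length := by simp at hi; omega
    simp [hil, hi', h.2 i hi']

/-- The marked vertices in increasing order. -/
def _root_.Finset.belowList (W : Finset ℕ) (n : ℕ) : List ℕ := (List.range n).filter (· ∈ W)

/-- The body is specified for an arbitrary list already written, so that the rule can be nested for
the rows and columns of the matrix. -/
theorem run_pushLoop {r : ℕ} {P : Cmd} {s : Store} {W : Finset ℕ} {g : ℕ → List ℕ}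
    {l : List ℕ} (hr : r ≠ 24) (hn : s.reg 0 = n) (hW : Indicates n (s.mem 4) W)
    (hP : P.writesMem 4 = false) (h : s.Written l)
    (hstep : ∀ x < n, x ∈ W → ∀ s', s'.reg r = x →
      (∀ q, q ≠ r → P.writes q = false → s'.reg q = s.reg q) →
      (∀ a, P.writesMem a = false → s'.mem a = s.mem a) →
      ∀ l, s'.Written l → (P.run s').Written (l ++ g x)) :
    ((loop r (cond (.load 4 (.reg r)) P skip)).run s).Written
      (l ++ (W.belowList n).flatMap g) := by
  have := run_loop (i := r) (P := cond (.load 4 (.reg r)) P skip) (s := s)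
    (fun j s' => s'.Written (l ++ (W.belowList j).flatMap g))
    (by
      rw [show W.belowList 0 = [] from rfl, List.flatMap_nil, List.append_nil]
      exact h.congr (by simp [Store.setReg, hr.symm]) rfl) ?_
  · rwa [hn] at this
  intro j hj s' hj' hreg hmem hI
  rw [hn] at hj
  refine Store.Written.congr (s := (cond (.load 4 (.reg r)) P skip).run s') ?_
    (by simp [Store.setReg, hr.symm]) rfl
  have h4 : (Expr.load 4 (.reg r)).eval s' = if j ∈ W then 1 else 0 := by
    rw [Expr.eval, Expr.eval, hj', hmem 4 (by simp [writesMem, hP]), hW j hj]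
  rw [run, h4, Finset.belowList, List.range_succ, List.filter_append, List.flatMap_append,
    ← List.append_assoc]
  by_cases hjW : j ∈ W
  · simp only [hjW, if_true, ne_eq, one_ne_zero, not_false_eq_true, decide_true,
      List.filter_cons_of_pos, List.filter_nil, List.flatMap_cons, List.flatMap_nil,
      List.append_nil]
    exact hstep j hj hjW s' hj' (fun q hq hw => hreg q hq (by simp [writes, hw]))
      (fun a ha => hmem a (by simp [writesMem, ha])) _ hI
  · simpa [hjW, run, Finset.belowList] using hI

/-- The minimum of two numbers. -/
def _root_.Expr.min (e e' : Expr) : Expr := .sub e (.sub e e')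

theorem _root_.Expr.eval_min (s : Store) (e e' : Expr) :
    (Expr.min e e').eval s = Min.min (e.eval s) (e'.eval s) := by
  simp only [Expr.min, Expr.eval]; omega

/-- Compute the numbers that occur in the output. -/
def summary : Cmd :=
  seq (sumIf 8 16 (.load 4 (.reg 8)) (.const 1))
    (seq (sumIf 8 19 (.load 4 (.reg 8)) (.sub (.load 3 (.reg 8)) (.add (.reg 3) (.reg 1))))
      (seq (mulOne 20 (.reg 16)) (seq (mulOne 21 (.sub (.reg 3) (.reg 1)))
        (mulOne 22 (.add (.smul 2 (.reg 1)) (.reg 16))))))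

/-- Write the number of vertices, the solution size and the threshold. -/
def writeHead : Cmd :=
  seq (push (.reg 16)) (seq (push (.reg 1))
    (push (.min (.sub (.add (.load 0 (.const 2)) (.reg 20)) (.add (.reg 19) (.reg 21)))
      (.add (.reg 22) (.const 1)))))

/-- Write the adjacency matrix. -/
def writeMatrix : Cmd :=
  loop 7 (cond (.load 4 (.reg 7))
    (loop 8 (cond (.load 4 (.reg 8)) (push (.adj 7 8)) skip)) skip)

/-- Write the weights. -/
def writeWeights : Cmd :=
  loop 7 (cond (.load 4 (.reg 7))
    (seq (sumIf 8 25 (.and (.load 4 (.reg 8)) (.adj 7 8)) (.const 1))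
      (push (.sub (.sub (.add (.min (.load 3 (.reg 7)) (.add (.reg 3) (.reg 1))) (.reg 16))
        (.sub (.reg 3) (.reg 1))) (.reg 25)))) skip)

/-- Write the compressed instance. -/
def output : Cmd := seq summary (seq writeHead (seq writeMatrix writeWeights))

theorem run_output {s : Store} (hG : HoldsGraph G n s) {k δ t : ℕ} (hkn : k ≤ n)
    (hk : s.reg 1 = k) (hδ : s.reg 3 = δ) (ht : s.mem 0 2 = t) {W : Finset ℕ}
    (hWn : W ⊆ Finset.range n) (hW : Indicates n (s.mem 4) W) (h24 : s.reg 24 = 0) :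
    (output.run s).Written (W.card :: k :: SimpleGraph.clampedThreshold k δ W.card
        (∑ v ∈ W, (G.nbCount v (Finset.range n) - (δ + k))) t ::
      ((W.belowList n).flatMap (fun v => (W.belowList n).flatMap fun u =>
        [if G.Adj v u then 1 else 0]) ++
      (W.belowList n).flatMap fun v =>
        [SimpleGraph.clampedDeg (fun v => G.nbCount v (Finset.range n)) k δ W.card v -
          G.nbCount v W])) := by
  have hn := hG.reg_zero
  have hfilter : (Finset.range n).filter (· ∈ W) = W := by
    ext v
    rw [Finset.mem_filter]
    exact ⟨fun h => h.2, fun h => ⟨hWn h, h⟩⟩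
  set s₁ := (sumIf 8 16 (.load 4 (.reg 8)) (.const 1)).run s with hs₁
  set s₂ := (sumIf 8 19 (.load 4 (.reg 8))
    (.sub (.load 3 (.reg 8)) (.add (.reg 3) (.reg 1)))).run s₁ with hs₂
  set s₃ := (mulOne 20 (.reg 16)).run s₂ with hs₃
  set s₄ := (mulOne 21 (.sub (.reg 3) (.reg 1))).run s₃ with hs₄
  set s₅ := (mulOne 22 (.add (.smul 2 (.reg 1)) (.reg 16))).run s₄ with hs₅
  have hmem₁ : s₁.mem = s.mem := funext fun a => by rw [hs₁, run_mem rfl]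
  have hmem₅ : s₅.mem = s.mem := funext fun a => by
    rw [hs₅, run_mem rfl, hs₄, run_mem rfl, hs₃, run_mem rfl, hs₂, run_mem rfl, hmem₁]
  have h16 : s₁.reg 16 = W.card := by
    rw [hs₁, run_sumIf (by omega) (by omega) (· ∈ W) (fun _ => 1), hn, hfilter,
      Finset.card_eq_sum_ones]
    intro j hj s' hj' hr hm
    rw [hn] at hj
    simp [Expr.eval, hj', hm, hW j hj]
  have h1₁ : s₁.reg 1 = k := by rw [hs₁, run_reg rfl, hk]
  have h3₁ : s₁.reg 3 = δ := by rw [hs₁, run_reg rfl, hδ]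
  have h19 : s₂.reg 19 = ∑ v ∈ W, (G.nbCount v (Finset.range n) - (δ + k)) := by
    rw [hs₂, run_sumIf (by omega) (by omega) (· ∈ W)
      (fun v => G.nbCount v (Finset.range n) - (δ + k)), hs₁, run_reg rfl, hn, hfilter]
    intro j hj s' hj' hr hm
    rw [hs₁, run_reg rfl, hn] at hj
    simp only [Expr.eval, hj', hm, hmem₁, hW j hj, hG.deg j hj, hr 3 (by omega) (by omega),
      hr 1 (by omega) (by omega), h1₁, h3₁]
    simp
  have h1₂ : s₂.reg 1 = k := by rw [hs₂, run_reg rfl, hs₁, run_reg rfl, hk]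
  have h0₂ : s₂.reg 0 = n := by rw [hs₂, run_reg rfl, hs₁, run_reg rfl, hn]
  have h16₂ : s₂.reg 16 = W.card := by rw [hs₂, run_reg rfl, h16]
  have h3₂ : s₂.reg 3 = δ := by rw [hs₂, run_reg rfl, hs₁, run_reg rfl, hδ]
  have h20 : s₃.reg 20 = k * W.card := run_mulOne (by omega) (by omega) (by omega) h1₂
    (by omega) fun s' hr _ => by rw [Expr.eval, hr 16 (by omega) (by omega), h16₂]
  have h1₃ : s₃.reg 1 = k := by rw [hs₃, run_reg rfl, h1₂]
  have h0₃ : s₃.reg 0 = n := by rw [hs₃, run_reg rfl, h0₂]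
  have h3₃ : s₃.reg 3 = δ := by rw [hs₃, run_reg rfl, h3₂]
  have h21 : s₄.reg 21 = k * (δ - k) := run_mulOne (by omega) (by omega) (by omega) h1₃
    (by omega) fun s' hr _ => by
      simp only [Expr.eval, hr 3 (by omega) (by omega), hr 1 (by omega) (by omega), h3₃, h1₃]
  have h1₄ : s₄.reg 1 = k := by rw [hs₄, run_reg rfl, h1₃]
  have h0₄ : s₄.reg 0 = n := by rw [hs₄, run_reg rfl, h0₃]
  have h16₄ : s₄.reg 16 = W.card := by rw [hs₄, run_reg rfl, hs₃, run_reg rfl, h16₂]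
  have h22 : s₅.reg 22 = k * (2 * k + W.card) := run_mulOne (by omega) (by omega) (by omega) h1₄
    (by omega) fun s' hr _ => by
      simp only [Expr.eval, Expr.eval_smul, hr 1 (by omega) (by omega), hr 16 (by omega) (by omega),
        h1₄, h16₄]
  have h24₅ : s₅.reg 24 = 0 := by
    rw [hs₅, run_reg rfl, hs₄, run_reg rfl, hs₃, run_reg rfl, hs₂, run_reg rfl, hs₁, run_reg rfl,
      h24]
  have h1₅ : s₅.reg 1 = k := by rw [hs₅, run_reg rfl, h1₄]
  have h3₅ : s₅.reg 3 = δ := by rw [hs₅, run_reg rfl, hs₄, run_reg rfl, h3₃]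
  have h16₅ : s₅.reg 16 = W.card := by rw [hs₅, run_reg rfl, h16₄]
  have h19₅ : s₅.reg 19 = ∑ v ∈ W, (G.nbCount v (Finset.range n) - (δ + k)) := by
    rw [hs₅, run_reg rfl, hs₄, run_reg rfl, hs₃, run_reg rfl, h19]
  have h20₅ : s₅.reg 20 = k * W.card := by rw [hs₅, run_reg rfl, hs₄, run_reg rfl, h20]
  have h21₅ : s₅.reg 21 = k * (δ - k) := by rw [hs₅, run_reg rfl, h21]
  have h0₅ : s₅.reg 0 = n := by rw [hs₅, run_reg rfl, h0₄]
  set s₆ := writeHead.run s₅ with hs₆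
  set s₇ := writeMatrix.run s₆ with hs₇
  have hrun : output.run s = writeWeights.run s₇ := rfl
  have hw₆ : s₆.Written [W.card, k, SimpleGraph.clampedThreshold k δ W.card
      (∑ v ∈ W, (G.nbCount v (Finset.range n) - (δ + k))) t] := by
    have e0 : s₅.Written [] := ⟨h24₅, by simp⟩
    have e1 := run_push e0 (e := .reg 16) h16₅
    have e2 := run_push e1 (e := .reg 1) (x := k) (by rw [Expr.eval, run_reg rfl, h1₅])
    refine run_push e2 ?_
    rw [Expr.eval_min, SimpleGraph.clampedThreshold]
    have hr : ∀ r, r ≠ 24 → ((push (.reg 1)).run ((push (.reg 16)).run s₅)).reg r = s₅.reg r :=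
      fun r hr => by
        rw [run_reg (by simp [push, writes, hr]), run_reg (by simp [push, writes, hr])]
    have hm : ((push (.reg 1)).run ((push (.reg 16)).run s₅)).mem 0 = s₅.mem 0 := by
      rw [run_mem (a := 0) rfl, run_mem (a := 0) rfl]
    simp only [Expr.eval, hm, hr 20 (by omega), hr 19 (by omega), hr 21 (by omega),
      hr 22 (by omega), h20₅, h19₅, h21₅, h22, hmem₅, ht]
  have hG₆ : HoldsGraph G n s₆ :=
    (hG.congr (by rw [h0₅, hn]) (by rw [hmem₅]) (by rw [hmem₅]) (by rw [hmem₅])).run rfl rfl rfl rfl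
  have hW₆ : Indicates n (s₆.mem 4) W := by rw [hs₆, run_mem rfl, hmem₅]; exact hW
  have hw₇ := run_pushLoop (r := 7) (by omega) hG₆.reg_zero hW₆ (by rfl) hw₆
    (P := loop 8 (cond (.load 4 (.reg 8)) (push (.adj 7 8)) skip))
    (g := fun v => (W.belowList n).flatMap fun u => [if G.Adj v u then 1 else 0])
    fun v hv _ s' hv' hr hm l hl => by
      have hG' : HoldsGraph G n s' := hG₆.congr (hr 0 (by omega) rfl) (hm 0 rfl) (hm 2 rfl)
        (hm 3 rfl)
      refine run_pushLoop (by omega) hG'.reg_zero (by rw [hm 4 rfl]; exact hW₆) rfl hl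
        fun u hu _ s'' hu' hr' hm' l' hl' => run_push hl' ?_
      exact HoldsGraph.eval_adj (hG'.congr (hr' 0 (by omega) rfl) (hm' 0 rfl) (hm' 2 rfl)
        (hm' 3 rfl)) ((hr' 7 (by omega) rfl).trans hv') hu' hv hu
  have hG₇ : HoldsGraph G n s₇ := hG₆.run rfl rfl rfl rfl
  have hW₇ : Indicates n (s₇.mem 4) W := by rw [hs₇, run_mem rfl]; exact hW₆
  have hw₈ := run_pushLoop (r := 7) (by omega) hG₇.reg_zero hW₇ (by rfl) hw₇
    (P := seq (sumIf 8 25 (.and (.load 4 (.reg 8)) (.adj 7 8)) (.const 1))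
      (push (.sub (.sub (.add (.min (.load 3 (.reg 7)) (.add (.reg 3) (.reg 1))) (.reg 16))
        (.sub (.reg 3) (.reg 1))) (.reg 25))))
    (g := fun v => [SimpleGraph.clampedDeg (fun v => G.nbCount v (Finset.range n)) k δ W.card v -
          G.nbCount v W])
    fun v hv _ s' hv' hr hm l hl => by
      have hG' : HoldsGraph G n s' := hG₇.congr (hr 0 (by omega) rfl) (hm 0 rfl) (hm 2 rfl)
        (hm 3 rfl)
      set s₈ := (sumIf 8 25 (.and (.load 4 (.reg 8)) (.adj 7 8)) (.const 1)).run s' with hs₈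
      have h25 : s₈.reg 25 = G.nbCount v W := by
        rw [hs₈, run_sumIf (by omega) (by omega) (fun u => u ∈ W ∧ G.Adj v u) (fun _ => 1),
          ← Finset.card_eq_sum_ones, SimpleGraph.nbCount, hG'.reg_zero, ← Finset.filter_filter,
          hfilter]
        intro u hu s'' hu' hr' hm'
        rw [hG'.reg_zero] at hu
        have hG'' : HoldsGraph G n s'' := hG'.congr (hr' 0 (by omega) (by omega)) (by rw [hm'])
          (by rw [hm']) (by rw [hm'])
        rw [Expr.eval_and (p := u ∈ W)
          (by simp only [Expr.eval, hu', hm', hm 4 rfl, hW₇ u hu])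
          (hG''.eval_adj ((hr' 7 (by omega) (by omega)).trans hv') hu' hv hu)]
        simp [Expr.eval]
      refine run_push (hl.congr (run_reg rfl _) (run_mem rfl _)) ?_
      have hs8r : ∀ r, r ≠ 7 → r ≠ 8 → r ≠ 24 → r ≠ 25 → s₈.reg r = s₅.reg r := by
        intro r h7 h8 h24 h25
        rw [hs₈, run_reg (by simp [sumIf, writes, h8, h25]),
          hr r h7 (by simp [sumIf, push, writes, h8, h24, h25]), hs₇,
          run_reg (by simp [writeMatrix, push, writes, h7, h8, h24]), hs₆,
          run_reg (by simp [writeHead, push, writes, h24])]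
      have h7₈ : s₈.reg 7 = v := by rw [hs₈, run_reg rfl, hv']
      have h3₈ : s₈.mem 3 v = G.nbCount v (Finset.range n) := by
        rw [hs₈, run_mem rfl, hG'.deg v hv]
      rw [← hs₈]
      simp only [Expr.eval, Expr.eval_min, h7₈, h3₈, h25, hs8r 3 (by omega) (by omega) (by omega)
        (by omega), hs8r 1 (by omega) (by omega) (by omega) (by omega),
        hs8r 16 (by omega) (by omega) (by omega) (by omega), h3₅, h1₅, h16₅,
        SimpleGraph.clampedDeg]
  have hw₉ : (writeWeights.run s₇).Written _ := hw₈
  rw [hrun]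
  simpa using hw₉

end Cmd

/-! ### The compression -/

namespace SimpleGraph

theorem nbCount_map {α : Type*} {H : SimpleGraph α} [DecidableRel H.Adj]
    {G : SimpleGraph ℕ} [DecidableRel G.Adj] (f : α ↪ ℕ)
    (hf : ∀ i j, H.Adj i j ↔ G.Adj (f i) (f j)) (v : α) (S : Finset α) :
    G.nbCount (f v) (S.map f) = H.nbCount v S := by
  unfold nbCount
  rw [Finset.filter_map, Finset.card_map]
  congr 1
  exact Finset.filter_congr fun i _ => (hf v i).symm

/-- Covered edges and weights in an induced subgraph. -/
theorem two_mul_coveredEdges_add {α : Type*} [Fintype α] {H : SimpleGraph α}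
    {G : SimpleGraph ℕ} [DecidableRel G.Adj] (f : α ↪ ℕ)
    (hf : ∀ i j, H.Adj i j ↔ G.Adj (f i) (f j)) {w : α → ℕ} {d : ℕ → ℕ}
    (hd : ∀ i, G.nbCount (f i) (Finset.univ.map f) + w i = d (f i)) (S : Finset α) :
    (2 * (coveredEdges H S + ∑ v ∈ S, w v : ℕ) : ℤ) = G.coverValue d (S.map f) := by
  classical
  push_cast
  rw [mul_add, two_mul_coveredEdges]
  unfold coverValue innerDeg
  simp only [Finset.sum_map, nbCount_map f hf, ← hd, Finset.sum_add_distrib]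
  push_cast
  ring

/-- It serves for both instances: for the input with zero weights and true degrees, for the output
with `f` enumerating `W` and clamped degrees. -/
theorem exists_cover_iff {α : Type*} [Fintype α] {H : SimpleGraph α}
    {G : SimpleGraph ℕ} [DecidableRel G.Adj] (f : α ↪ ℕ)
    (hf : ∀ i j, H.Adj i j ↔ G.Adj (f i) (f j)) {w : α → ℕ} {d : ℕ → ℕ}
    (hd : ∀ i, G.nbCount (f i) (Finset.univ.map f) + w i = d (f i)) (k t : ℕ) :
    (∃ S : Finset α, S.card = k ∧ t ≤ coveredEdges H S + ∑ v ∈ S, w v) ↔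
      ∃ S ⊆ Finset.univ.map f, S.card = k ∧ (2 * t : ℤ) ≤ G.coverValue d S := by
  constructor
  · rintro ⟨S, hS, ht⟩
    refine ⟨S.map f, Finset.map_subset_map.2 (Finset.subset_univ _), by simpa using hS, ?_⟩
    rw [← two_mul_coveredEdges_add f hf hd S]
    omega
  · rintro ⟨T, hT, hk, ht⟩
    obtain ⟨S, -, rfl⟩ := Finset.subset_map_iff.1 hT
    rw [← two_mul_coveredEdges_add f hf hd S] at ht
    exact ⟨S, by simpa using hk, by omega⟩

theorem K33Free.map {V V' : Type*} {G : SimpleGraph V} (hG : G.K33Free) (f : V ↪ V') :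
    (G.map f).K33Free := by
  intro p q hp hq h
  have hu : ∀ i, ∃ u, f u = p i := fun i => by
    obtain ⟨u, -, -, hu, -⟩ := (SimpleGraph.map_adj f G _ _).1 (h i 0)
    exact ⟨u, hu⟩
  have hv : ∀ j, ∃ v, f v = q j := fun j => by
    obtain ⟨-, v, -, -, hv⟩ := (SimpleGraph.map_adj f G _ _).1 (h 0 j)
    exact ⟨v, hv⟩
  choose u hu using hu
  choose v hv using hv
  refine hG u v (fun i j hij => hp ?_) (fun i j hij => hq ?_) fun i j => ?_
  · rw [← hu, ← hu, hij]
  · rw [← hv, ← hv, hij]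
  · have := h i j
    rwa [← hu, ← hv, SimpleGraph.map_adj_apply] at this

end SimpleGraph

/-! ### Sizes and entries of encodings -/

theorem bitSize_le_of_forall_le {l : List ℕ} {B : ℕ} (h : ∀ a ∈ l, a ≤ B) :
    bitSize l ≤ l.length * (B + 1) := by
  unfold bitSize
  rw [← List.length_map (f := fun a => Nat.size a + 1) (as := l), ← smul_eq_mul]
  refine List.sum_le_card_nsmul _ _ fun x hx => ?_
  obtain ⟨a, ha, rfl⟩ := List.mem_map.1 hx
  have : Nat.size a ≤ a := Nat.size_le.2 Nat.lt_two_pow_self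
  have := h a ha
  omega

theorem length_le_bitSize (l : List ℕ) : l.length ≤ bitSize l := by
  induction l with
  | nil => simp [bitSize]
  | cons a l ih =>
    unfold bitSize at ih ⊢
    rw [List.map_cons, List.sum_cons, List.length_cons]
    omega

theorem Polynomial.eval_mono_nat (p : Polynomial ℕ) {a b : ℕ} (h : a ≤ b) :
    p.eval a ≤ p.eval b := by
  rw [Polynomial.eval_eq_sum, Polynomial.eval_eq_sum]
  exact Finset.sum_le_sum fun i _ => Nat.mul_le_mul_left _ (Nat.pow_le_pow_left h i)

theorem adjacencyBits_getD {n : ℕ} (H : SimpleGraph (Fin n)) {u v : ℕ} (hu : u < n) (hv : v < n)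
    (G : SimpleGraph ℕ) [DecidableRel G.Adj] (hG : H.Adj ⟨u, hu⟩ ⟨v, hv⟩ ↔ G.Adj u v) :
    (adjacencyBits H).getD (u * n + v) 0 = if G.Adj u v then 1 else 0 := by
  have hlt : u * n + v < n * n := by
    calc u * n + v < u * n + n := by omega
      _ = (u + 1) * n := by ring
      _ ≤ n * n := Nat.mul_le_mul_right _ hu
  rw [List.getD_eq_getElem _ _ (by simpa [adjacencyBits] using hlt)]
  have h1 : (⟨u * n + v, hlt⟩ : Fin (n * n)).divNat = ⟨u, hu⟩ := by
    ext; simp [Fin.divNat, Nat.mul_comm u n, Nat.mul_add_div (show 0 < n by omega),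
      Nat.div_eq_of_lt hv]
  have h2 : (⟨u * n + v, hlt⟩ : Fin (n * n)).modNat = ⟨v, hv⟩ := by
    ext; simp [Fin.modNat, Nat.mul_comm u n, Nat.mod_eq_of_lt hv]
  simp only [adjacencyBits, List.getElem_ofFn]
  rw [h1, h2]
  simp only [hG]

/-- The subgraph of `G` induced by the entries of a list. -/
def listGraph (G : SimpleGraph ℕ) (l : List ℕ) : SimpleGraph (Fin l.length) := G.comap l.get

theorem List.ofFn_comp_get {α β : Type*} (F : α → β) (l : List α) :
    List.ofFn (fun i => F (l.get i)) = l.map F := by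
  conv_rhs => rw [← List.ofFn_get l, List.map_ofFn]
  rfl

theorem adjacencyBits_listGraph (G : SimpleGraph ℕ) [DecidableRel G.Adj] (l : List ℕ) :
    adjacencyBits (listGraph G l) =
      l.flatMap fun v => l.flatMap fun u => [if G.Adj v u then 1 else 0] := by
  have h1 : ∀ (i j : Fin l.length) h,
      (⟨i * l.length + j, h⟩ : Fin (l.length * l.length)).divNat = i := fun i j h => by
    ext
    simp [Fin.divNat, Nat.mul_comm (i : ℕ), Nat.mul_add_div (show 0 < l.length from i.pos),
      Nat.div_eq_of_lt j.2]
  have h2 : ∀ (i j : Fin l.length) h,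
      (⟨i * l.length + j, h⟩ : Fin (l.length * l.length)).modNat = j := fun i j h => by
    ext; simp [Fin.modNat, Nat.mul_comm (i : ℕ), Nat.mod_eq_of_lt j.2]
  simp only [← List.map_eq_flatMap]
  rw [List.flatMap_def, ← List.ofFn_comp_get, adjacencyBits, List.ofFn_mul]
  simp only [h1, h2, ← List.ofFn_comp_get, listGraph, SimpleGraph.comap_adj]

theorem Finset.toFinset_belowList {W : Finset ℕ} {n : ℕ} (h : W ⊆ Finset.range n) :
    (W.belowList n).toFinset = W := by
  ext v
  simp only [Finset.belowList, List.mem_toFinset, List.mem_filter, List.mem_range,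
    decide_eq_true_eq]
  exact ⟨fun h => h.2, fun hv => ⟨Finset.mem_range.1 (h hv), hv⟩⟩

theorem Finset.nodup_belowList (W : Finset ℕ) (n : ℕ) : (W.belowList n).Nodup :=
  List.Nodup.filter _ List.nodup_range

theorem Finset.length_belowList {W : Finset ℕ} {n : ℕ} (h : W ⊆ Finset.range n) :
    (W.belowList n).length = W.card := by
  rw [← List.toFinset_card_of_nodup (W.nodup_belowList n), toFinset_belowList h]

namespace Cmd

/-- The compression after the number of vertices has been read. -/
def compression : Cmd :=
  seq (assign 1 (.load 0 (.const 1))) (cond (.le (.reg 1) (.reg 0))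
    (seq setup (seq markAll output)) (store 1 (.const 1) (.reg 1)))

theorem compression_wf : compression.wf = true := rfl

/-- The program computes an equivalent instance of the required size. -/
theorem run_compression {I : PVCInstance} (hI : I.graph.K33Free) (hk : 0 < I.k) :
    ∃ J : WeightedPVCInstance,
      (∀ i (h : i < J.encode.length),
        (compression.run ((Store.init I.encode).setReg 0 I.n)).mem 1 i = J.encode[i]) ∧
      J.k = I.k ∧ J.n ≤ 183 * I.k ^ 3 ∧ (∀ v, J.weight v ≤ 2 * I.k + J.n) ∧
      J.t ≤ I.k * (2 * I.k + J.n) + 1 ∧ (I.IsYes ↔ J.IsYes) := by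
  set s := ((Store.init I.encode).setReg 0 I.n) with hs
  set s₀ := (assign 1 (.load 0 (.const 1))).run s with hs₀
  have h0 : s₀.reg 0 = I.n := rfl
  have h1 : s₀.reg 1 = I.k := rfl
  by_cases hkn : I.k ≤ I.n
  · have hrun : compression.run s = output.run (markAll.run (setup.run s₀)) := by
      change (if (Expr.le (.reg 1) (.reg 0)).eval s₀ ≠ 0 then
        (seq setup (seq markAll output)).run s₀ else (store 1 (.const 1) (.reg 1)).run s₀) = _
      rw [Expr.eval_le, Expr.eval, Expr.eval, h0, h1, if_pos hkn, if_pos one_ne_zero]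
      rfl
    let G : SimpleGraph ℕ := I.graph.map Fin.valEmbedding
    let _ : DecidableRel G.Adj := Classical.decRel _
    have hG : G.K33Free := hI.map _
    have hadj : ∀ u v : Fin I.n, I.graph.Adj u v ↔ G.Adj u v := fun u v =>
      (SimpleGraph.map_adj_apply (f := Fin.valEmbedding)).symm
    have hmat : ∀ u < I.n, ∀ v < I.n,
        s₀.mem 0 (3 + u * I.n + v) = if G.Adj u v then 1 else 0 := by
      intro u hu v hv
      rw [← adjacencyBits_getD I.graph hu hv G (hadj ⟨u, hu⟩ ⟨v, hv⟩)]
      change I.encode.getD (3 + u * I.n + v) 0 = _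
      -- The matrix starts after the three entries for `n`, `k` and `t`.
      rw [show 3 + u * I.n + v = u * I.n + v + 1 + 1 + 1 by ring, PVCInstance.encode]
      simp only [List.getD_cons_succ]
    obtain ⟨δ, hgr, hpar, hδ, hδ'⟩ := run_setup h0 h1 hk hkn hmat
    obtain ⟨W, hWE, hWc, hrep, hW⟩ := run_markAll hG hgr hk hpar fun x _ => by
      rw [run_mem (by rfl)]; rfl
    have hWn : W ⊆ Finset.range I.n := hWE.trans (Finset.filter_subset _ _)
    have hout := run_output (t := I.t)
      (hgr.run (markAll_writes (by omega)) (markAll_writesMem (by omega))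
        (markAll_writesMem (by omega)) (markAll_writesMem (by omega))) hkn
      (by rw [run_reg (markAll_writes (by omega)), hpar.reg_one])
      (by rw [run_reg (markAll_writes (by omega)), hpar.reg_three])
      (by rw [run_mem (markAll_writesMem (by omega)), run_mem (by rfl)]; rfl) hWn hW
      (by rw [run_reg (markAll_writes (by omega)), run_reg (by rfl)]; rfl)
    rw [← hrun] at hout
    have hlen := Finset.length_belowList hWn
    set l := W.belowList I.n with hl
    set d := fun v => G.nbCount v (Finset.range I.n) with hd
    let J : WeightedPVCInstance :=
      { n := l.length
        graph := listGraph G l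
        weight := fun i =>
          SimpleGraph.clampedDeg d I.k δ W.card (l.get i) - G.nbCount (l.get i) W
        k := I.k
        t := SimpleGraph.clampedThreshold I.k δ W.card (∑ v ∈ W, (d v - (δ + I.k))) I.t }
    have hJ : J.encode = W.card :: I.k :: SimpleGraph.clampedThreshold I.k δ W.card
        (∑ v ∈ W, (d v - (δ + I.k))) I.t ::
      (l.flatMap (fun v => l.flatMap fun u => [if G.Adj v u then 1 else 0]) ++
        l.flatMap fun v => [SimpleGraph.clampedDeg d I.k δ W.card v - G.nbCount v W]) := by
      change l.length :: _ :: _ :: (adjacencyBits (listGraph G l) ++ List.ofFn (fun i =>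
        SimpleGraph.clampedDeg d I.k δ W.card (l.get i) - G.nbCount (l.get i) W)) = _
      rw [List.ofFn_comp_get (fun v => SimpleGraph.clampedDeg d I.k δ W.card v - G.nbCount v W),
        adjacencyBits_listGraph, hlen]
      simp only [List.map_eq_flatMap]
      rfl
    refine ⟨J, ?_, rfl, ?_, fun v => ?_, ?_, ?_⟩
    · rw [hJ]; exact hout.2
    · rw [show J.n = W.card from hlen]; exact hWc
    · rw [show J.n = W.card from hlen]
      exact (Nat.sub_le _ _).trans (SimpleGraph.clampedDeg_le _ _ _ _ _)
    · rw [show J.n = W.card from hlen]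
      exact min_le_right _ _
    · let f : Fin l.length ↪ ℕ := ⟨l.get, (W.nodup_belowList I.n).injective_get⟩
      have hf : Finset.univ.map f = W := by
        rw [← Finset.toFinset_belowList hWn]
        ext x
        simp [f, List.mem_iff_get, hl]
        rfl
      have hU : (Finset.univ : Finset (Fin I.n)).map Fin.valEmbedding = Finset.range I.n := by
        rw [Fin.map_valEmbedding_univ]; ext; simp
      have hyes := SimpleGraph.exists_cover_iff (H := I.graph) (G := G) Fin.valEmbedding hadj
        (w := 0) (d := d) (fun i => by rw [hU]; rfl) I.k I.t
      simp only [hU, Pi.zero_apply, Finset.sum_const_zero, add_zero] at hyes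
      have hyes' := SimpleGraph.exists_cover_iff (H := J.graph) (G := G) f
        (fun i j => Iff.rfl) (w := J.weight) (d := SimpleGraph.clampedDeg d I.k δ W.card)
        (fun i => by
          rw [hf]
          have hi : l.get i ∈ W := by
            have := (List.mem_filter.1
              (show l.get i ∈ (List.range I.n).filter (· ∈ W) from List.get_mem l i)).2
            simpa using this
          -- The subtraction in the weight is exact: the shift by `W.card` makes the clamped degree
          -- at least the number of neighbours in `W`.
          exact Nat.add_sub_cancel' ((SimpleGraph.nbCount_le _ _).trans
            (SimpleGraph.le_clampedDeg _ (Finset.mem_filter.1 (hWE hi)).2))) J.k J.t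
      unfold PVCInstance.IsYes WeightedPVCInstance.IsYes
      rw [hyes, hyes', hf]
      exact hrep.exists_iff hG hk hδ hδ' hWE I.t
  · have hrun : compression.run s = (store 1 (.const 1) (.reg 1)).run s₀ := by
      change (if (Expr.le (.reg 1) (.reg 0)).eval s₀ ≠ 0 then
        (seq setup (seq markAll output)).run s₀ else (store 1 (.const 1) (.reg 1)).run s₀) = _
      rw [Expr.eval_le, Expr.eval, Expr.eval, h0, h1, if_neg hkn, if_neg (not_not.2 rfl)]
    -- With fewer than `k` vertices the input is a no-instance, and so is the empty graph because
    -- `k` is positive. The other output cells are zero from the start.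
    let J : WeightedPVCInstance :=
      { n := 0, graph := ⊥, weight := fun _ => 0, k := I.k, t := 0 }
    have hJ : J.encode = [0, I.k, 0] := by
      simp [WeightedPVCInstance.encode, adjacencyBits, J]
    refine ⟨J, ?_, rfl, Nat.zero_le _, fun v => Nat.zero_le _, Nat.zero_le _, ?_⟩
    · rw [hJ, hrun]
      intro i hi
      have hi3 : i < 3 := hi
      interval_cases i <;> rfl
    · constructor
      · rintro ⟨S, hS, -⟩
        have := Finset.card_le_univ S
        rw [Fintype.card_fin] at this
        omega
      · rintro ⟨S, hS, -⟩
        have := Finset.card_le_univ S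
        rw [Fintype.card_fin] at this
        have hS' : S.card = I.k := hS
        have h0 : J.n = 0 := rfl
        omega

end Cmd

theorem corollary1 :
    ∃ (P : Prog) (f : planarPVC.Inst → WeightedPVCInstance),
      IsPolynomialCompression planarPVC weightedPVC P f ∧
      ∃ c : ℕ, ∀ I : planarPVC.Inst,
        (f I).k = I.1.k ∧
        (f I).n ≤ c * I.1.k ^ 3 ∧
        ∀ v : Fin (f I).n, Nat.size ((f I).weight v) ≤ c * I.1.k := by
  choose f hout hfk hfn hfw hft hyes using fun I : planarPVC.Inst =>
    Cmd.run_compression I.2.1.k33Free I.2.2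
  -- The first instruction puts the number of vertices into register `0`, the bound of all loops.
  -- With `N = 183 * k ^ 3`, the output has at most `3 + (N * N + N)` entries; the second factor of
  -- the size polynomial bounds each entry plus one, since a number has no more bits than its value.
  refine ⟨.seq (.assign 0 (.load 0 (.const 0))) Cmd.compression.toProg, f,
    ⟨1 + Cmd.compression.time,
      (3 + ((183 * Polynomial.X ^ 3) * (183 * Polynomial.X ^ 3) + 183 * Polynomial.X ^ 3)) *
        (Polynomial.X * (2 * Polynomial.X + 183 * Polynomial.X ^ 3) + 1 +
          (3 * Polynomial.X + 183 * Polynomial.X ^ 3) + 2), fun I => ⟨?_, ?_, hyes I⟩⟩, 183, fun I =>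
      ⟨hfk I, hfn I, fun v => ?_⟩⟩
  · obtain ⟨T, hT, hr⟩ := Cmd.exists_runs Cmd.compression_wf
      ((Store.init I.1.encode).setReg 0 I.1.n)
    refine ⟨1 + T, ?_, _, (Prog.Runs.assign _ _ _).seq hr, hout I⟩
    rw [Polynomial.eval_add, Polynomial.eval_one]
    refine Nat.add_le_add_left (hT.trans (Polynomial.eval_mono_nat _ ?_)) _
    have h1 := length_le_bitSize I.1.encode
    have h2 : I.1.n ≤ I.1.encode.length := by
      simp only [PVCInstance.encode, adjacencyBits, List.length_cons, List.length_ofFn]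
      have := Nat.le_mul_self I.1.n
      omega
    exact (h2.trans h1).trans (Nat.le_add_right _ _)
  · generalize hJ : f I = J at *
    have hn := hfn I
    have hk := hfk I
    have hw := hfw I
    have ht := hft I
    rw [hJ] at hn hk hw ht
    change bitSize J.encode ≤ Polynomial.eval I.1.k _
    generalize I.1.k = k at *
    have hB : ∀ a ∈ J.encode,
        a ≤ k * (2 * k + 183 * k ^ 3) + 1 + (3 * k + 183 * k ^ 3) + 1 := by
      intro a ha
      simp only [WeightedPVCInstance.encode, adjacencyBits, List.mem_cons, List.mem_append,
        List.mem_ofFn] at ha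
      rcases ha with rfl | rfl | rfl | ⟨i, rfl⟩ | ⟨i, rfl⟩
      · omega
      · omega
      · have := Nat.mul_le_mul_left k (Nat.add_le_add_left hn (2 * k))
        omega
      · split_ifs <;> omega
      · have := hw i
        omega
    refine (bitSize_le_of_forall_le hB).trans ?_
    have hlen : J.encode.length = 3 + (J.n * J.n + J.n) := by
      simp only [WeightedPVCInstance.encode, adjacencyBits, List.length_cons, List.length_append,
        List.length_ofFn]
      ring
    rw [hlen]
    simp only [Polynomial.eval_mul, Polynomial.eval_add, Polynomial.eval_ofNat,
      Polynomial.eval_pow, Polynomial.eval_X, Polynomial.eval_one]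
    exact Nat.mul_le_mul (Nat.add_le_add_left (Nat.add_le_add (Nat.mul_le_mul hn hn) hn) _)
      (by omega)
  · have hn := hfn I
    have hw := hfw I v
    have hk : 0 < I.1.k := I.2.2
    generalize I.1.k = k at *
    rw [Nat.size_le]
    have h1 : k ^ 3 ≤ (2 ^ k) ^ 3 := Nat.pow_le_pow_left Nat.lt_two_pow_self.le 3
    have h2 : k ≤ k ^ 3 := Nat.le_self_pow (by norm_num) k
    -- Weights are at most `185 * k ^ 3`, and `k < 2 ^ k`; this crude estimate already gives
    -- linearly many bits.
    calc (f I).weight v < 2 ^ 8 * (2 ^ k) ^ 3 := by omega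
      _ = 2 ^ (8 + k * 3) := by rw [← pow_mul, ← pow_add]
      _ ≤ 2 ^ (183 * k) := Nat.pow_le_pow_right (by norm_num) (by omega)
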